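/- Let $d\ge 1$. Let $\mathcal F_d$ be the projective space, with its Zariski topology, of nonzero homogeneous 1-forms $\omega=A\,dx+B\,dy+C\,dz$ on $\mathbb C^3$ up to nonzero scalars, where $A,B,C\in\mathbb C[x,y,z]$ are homogeneous of degree $d+1$ and $xA+yB+zC=0$. A point of $\mathcal F_d$ is a foliation of degree $d$ on $\mathbb{CP}^2$ when $A,B,C$ have no common factor; its singular points are the points of $\mathbb{CP}^2$ at which $A,B,C$ all vanish. A homogeneous vector field $P\,\partial_x+Q\,\partial_y+R\,\partial_z$ of degree $d$ defines the 1-form $(yR-zQ)\,dx+(zP-xR)\,dy+(xQ-yP)\,dz$. The group $SL(3,\mathbb C)$ acts on $\mathcal F_d$ by linear changes of coordinates, $g\cdot[\omega]=[(g^{-1})^*\omega]$. We say that $[\omega]$ has a rational first integral of degree $s$ given by the pencil $\{\alpha G-\beta H\}_{(\alpha:\beta)\in\mathbb{CP}^1}$ if $G,H$ are homogeneous polynomials of degree $s$ without common factor, all but finitely many members of the pencil are irreducible, and $G\,dH-H\,dG=R\,\omega$ for some polynomial $R\neq0$. Let $\mathcal R(d,d+1)\subset\mathcal F_d$ be the union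 of the $SL(3,\mathbb C)$-orbits of the points $F_P$ defined by the vector fields $$P(y,z)\,\frac{\partial}{\partial x}+z^d\,\frac{\partial}{\partial y},$$ where $P\in\mathbb C[y,z]$ is homogeneous of degree $d$ and $P(y,0)\neq 0$. Then: 1. $\mathcal R(d,d+1)$ is an irreducible, locally closed subvariety of $\mathcal F_d$ of dimension $d+4$. 2. Every member of $\mathcal R(d,d+1)$ is a foliation of degree $d$ (its coefficients have no common factor) with a unique singular point and with a rational first integral of degree $d+1$. 3. Explicitly, if $P(y,z)=\sum_{i=0}^d a_i y^i z^{d-i}$ with $a_d\ne0$, then $F_P$ has a rational first integral of degree $d+1$ given by the pencil $$\left\{\alpha\left(\sum_{i=0}^d\frac{a_i}{i+1}\,y^{i+1}z^{d-i}-xz^d\right)-\beta z^{d+1}\right\}_{(\alpha:\beta)\in\mathbb{CP}^1},$$ and, for every $g\in SL(3,\mathbb C)$, $g\cdot F_P$ has a rational first integral of degree $d+1$ given by the pencil obtained from this one by composing its members with $g^{-1}$. -/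

import Mathlib

open MvPolynomial
open scoped LinearAlgebra.Projectivization MatrixGroups

noncomputable section

namespace PlaneFoliation

/-- Complex polynomials in the homogeneous coordinates `x = X 0`, `y = X 1`, `z = X 2`. -/
abbrev Poly3 := MvPolynomial (Fin 3) ℂ

/-! ### The Zariski topology on a projective space -/

section Zariski

variable (V : Type*) [AddCommGroup V] [Module ℂ V]

/-- The polynomial functions on `V`, as polynomials in the linear forms on `V`. -/
abbrev PolyFun := MvPolynomial (Module.Dual ℂ V) ℂ

variable {V}

/-- The value of a polynomial function at a vector. -/
def evalAt (v : V) (p : PolyFun V) : ℂ := eval (fun φ : Module.Dual ℂ V => φ v) p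

/-- The common zeros in `ℙ(V)` of a set of homogeneous polynomial functions on `V`
(for homogeneous `p`, vanishing does not depend on the representative of the point). -/
def zeroLocus (S : Set (PolyFun V)) : Set (ℙ ℂ V) := {x | ∀ p ∈ S, evalAt x.rep p = 0}

/-- Closed sets: the common zeros of homogeneous polynomial functions. -/
def IsZariskiClosed (Z : Set (ℙ ℂ V)) : Prop :=
  ∃ S : Set (PolyFun V), (∀ p ∈ S, ∃ n, p.IsHomogeneous n) ∧ Z = zeroLocus S

variable (V) in
/-- The Zariski topology on the projective space `ℙ(V)`. -/
@[reducible]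
def zariskiTopology : TopologicalSpace (ℙ ℂ V) :=
  TopologicalSpace.ofClosed {Z | IsZariskiClosed Z}
    ⟨{1}, by
      rintro p rfl
      exact ⟨0, isHomogeneous_one _ _⟩, by
      ext x
      simp [zeroLocus, evalAt]⟩
    (by
      intro A hA
      have hA' : ∀ Z : Set (ℙ ℂ V), ∃ S : Set (PolyFun V), Z ∈ A →
          (∀ p ∈ S, ∃ n, p.IsHomogeneous n) ∧ Z = zeroLocus S := fun Z => by
        by_cases h : Z ∈ A
        · obtain ⟨S, hS⟩ := hA h
          exact ⟨S, fun _ => hS⟩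
        · exact ⟨∅, fun h' => absurd h' h⟩
      choose S hS using hA'
      refine ⟨{p | ∃ Z ∈ A, p ∈ S Z}, ?_, ?_⟩
      · rintro p ⟨Z, hZA, hp⟩
        exact (hS Z hZA).1 p hp
      · ext x
        constructor
        · rintro h p ⟨Z, hZA, hp⟩
          have hx := h Z hZA
          rw [(hS Z hZA).2] at hx
          exact hx p hp
        · intro h Z hZA
          rw [(hS Z hZA).2]
          exact fun p hp => h p ⟨Z, hZA, hp⟩)
    (by
      rintro _ ⟨S, hS, rfl⟩ _ ⟨T, hT, rfl⟩
      refine ⟨{r | ∃ p ∈ S, ∃ q ∈ T, r = p * q}, ?_, ?_⟩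
      · rintro _ ⟨p, hp, q, hq, rfl⟩
        obtain ⟨m, hm⟩ := hS p hp
        obtain ⟨n, hn⟩ := hT q hq
        exact ⟨m + n, hm.mul hn⟩
      · ext x
        constructor
        · rintro (h | h) _ ⟨p, hp, q, hq, rfl⟩
          · simp [evalAt, show eval _ p = 0 from h p hp]
          · simp [evalAt, show eval _ q = 0 from h q hq]
        · intro h
          by_contra hc
          obtain ⟨hc1, hc2⟩ := not_or.mp hc
          obtain ⟨p, hp⟩ := not_forall.mp hc1
          obtain ⟨q, hq⟩ := not_forall.mp hc2
          obtain ⟨hp, hp0⟩ := Classical.not_imp.mp hp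
          obtain ⟨hq, hq0⟩ := Classical.not_imp.mp hq
          have := h _ ⟨p, hp, q, hq, rfl⟩
          rw [evalAt, map_mul] at this
          exact (mul_ne_zero hp0 hq0) this)

end Zariski

/-! ### Linear changes of coordinates -/

/-- The polynomial `f ∘ M`, i.e. `v ↦ f (M v)`. -/
def comp (M : Matrix (Fin 3) (Fin 3) ℂ) : Poly3 →ₐ[ℂ] Poly3 :=
  aeval (fun i => ∑ j, C (M i j) * X j)

theorem comp_X (M : Matrix (Fin 3) (Fin 3) ℂ) (i : Fin 3) :
    comp M (X i) = ∑ j, C (M i j) * X j := by simp [comp]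

theorem comp_C (M : Matrix (Fin 3) (Fin 3) ℂ) (c : ℂ) : comp M (C c) = C c := by
  simp [comp, algebraMap_eq]

theorem comp_one (f : Poly3) : comp 1 f = f := by
  have : comp 1 = AlgHom.id ℂ Poly3 := by
    apply MvPolynomial.algHom_ext
    intro i
    simp [comp_X, Matrix.one_apply]
  rw [this]; rfl

theorem comp_comp (M N : Matrix (Fin 3) (Fin 3) ℂ) (f : Poly3) :
    comp M (comp N f) = comp (N * M) f := by
  have : (comp M).comp (comp N) = comp (N * M) := by
    apply MvPolynomial.algHom_ext
    intro i
    simp only [AlgHom.comp_apply, comp_X, map_sum, map_mul, comp_C, Matrix.mul_apply,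
      Finset.mul_sum, Finset.sum_mul]
    rw [Finset.sum_comm]
    simp only [mul_assoc]
  exact DFunLike.congr_fun this f

theorem comp_isHomogeneous (M : Matrix (Fin 3) (Fin 3) ℂ) {f : Poly3} {n : ℕ}
    (hf : f.IsHomogeneous n) : (comp M f).IsHomogeneous n := by
  have h := hf.aeval (fun i => ∑ j, C (M i j) * (X j : Poly3)) (n := 1) (fun i =>
    IsHomogeneous.sum _ _ _ fun j _ => by
      simpa using (isHomogeneous_C (Fin 3) (M i j)).mul (isHomogeneous_X ℂ j))
  simpa [comp] using h

/-! ### Homogeneous 1-forms and vector fields -/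

/-- The homogeneous 1-forms `A dx + B dy + C dz` with `A`, `B`, `C` homogeneous of degree `d + 1`
and `x A + y B + z C = 0`; the form is stored as the vector `(A, B, C)`. -/
def Form (d : ℕ) : Submodule ℂ (Fin 3 → Poly3) where
  carrier := {A | (∀ i, (A i).IsHomogeneous (d + 1)) ∧ ∑ i, X i * A i = 0}
  add_mem' := by
    rintro A B ⟨hA, hA'⟩ ⟨hB, hB'⟩
    refine ⟨fun i => (hA i).add (hB i), ?_⟩
    simp [mul_add, Finset.sum_add_distrib, hA', hB']
  zero_mem' := ⟨fun _ => isHomogeneous_zero _ _ _, by simp⟩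
  smul_mem' := by
    rintro c A ⟨hA, hA'⟩
    refine ⟨fun i => (homogeneousSubmodule (Fin 3) ℂ (d + 1)).smul_mem c (hA i), ?_⟩
    simp only [Pi.smul_apply, mul_smul_comm, ← Finset.smul_sum, hA', smul_zero]

/-- The homogeneous vector fields `P ∂/∂x + Q ∂/∂y + R ∂/∂z` of degree `d`. -/
def VectorField (d : ℕ) : Submodule ℂ (Fin 3 → Poly3) :=
  Submodule.pi Set.univ fun _ => homogeneousSubmodule (Fin 3) ℂ d

/-- The 1-form `(yR - zQ) dx + (zP - xR) dy + (xQ - yP) dz` of the vector field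
`P ∂/∂x + Q ∂/∂y + R ∂/∂z`. -/
def toForm {d : ℕ} (W : VectorField d) : Form d :=
  ⟨![X 1 * W.1 2 - X 2 * W.1 1, X 2 * W.1 0 - X 0 * W.1 2, X 0 * W.1 1 - X 1 * W.1 0], by
    have h : ∀ i j : Fin 3, (X i * W.1 j : Poly3).IsHomogeneous (d + 1) := fun i j => by
      have hj : (W.1 j).IsHomogeneous d := W.2 j (Set.mem_univ j)
      rw [add_comm]
      exact (isHomogeneous_X ℂ i).mul hj
    refine ⟨fun i => ?_, ?_⟩
    · fin_cases i
      · exact (h 1 2).sub (h 2 1)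
      · exact (h 2 0).sub (h 0 2)
      · exact (h 0 1).sub (h 1 0)
    · simp only [Fin.sum_univ_three, Matrix.cons_val]
      ring⟩

/-- The pull-back `M^* ω`, given by `(M^* ω)(v)(w) = ω(M v)(M w)`. -/
def pullback {d : ℕ} (M : Matrix (Fin 3) (Fin 3) ℂ) (ω : Form d) : Form d :=
  ⟨fun j => ∑ i, C (M i j) * comp M (ω.1 i), by
    refine ⟨fun j => IsHomogeneous.sum _ _ _ fun i _ => ?_, ?_⟩
    · simpa using (isHomogeneous_C (Fin 3) (M i j)).mul (comp_isHomogeneous M (ω.2.1 i))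
    · have h := congrArg (comp M) ω.2.2
      simp only [map_sum, map_mul, comp_X, map_zero, Finset.sum_mul] at h
      rw [← h]
      simp only [Finset.mul_sum]
      rw [Finset.sum_comm]
      refine Finset.sum_congr rfl fun j _ => Finset.sum_congr rfl fun i _ => ?_
      ring⟩

theorem pullback_one {d : ℕ} (ω : Form d) : pullback 1 ω = ω := by
  apply Subtype.ext
  funext j
  simp [pullback, comp_one, Matrix.one_apply]

theorem pullback_pullback {d : ℕ} (M N : Matrix (Fin 3) (Fin 3) ℂ) (ω : Form d) :
    pullback M (pullback N ω) = pullback (N * M) ω := by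
  apply Subtype.ext
  funext j
  simp only [pullback, map_sum, map_mul, comp_C, comp_comp, Matrix.mul_apply, Finset.mul_sum,
    Finset.sum_mul]
  rw [Finset.sum_comm]
  refine Finset.sum_congr rfl fun i _ => Finset.sum_congr rfl fun k _ => ?_
  ring

/-- `SL(3,ℂ)` acts on 1-forms by changes of coordinates, `g • ω = (g⁻¹)^* ω`. For `ω` coming from
a vector field `W` this is the 1-form of the transported vector field `v ↦ g W(g⁻¹ v)`. -/
instance (d : ℕ) : DistribMulAction SL(3, ℂ) (Form d) where
  smul g ω := pullback (g⁻¹).1 ω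
  one_smul ω := by
    change pullback ((1 : SL(3, ℂ))⁻¹).1 ω = ω
    rw [inv_one]
    exact pullback_one ω
  mul_smul g h ω := by
    change pullback ((g * h)⁻¹).1 ω = pullback (g⁻¹).1 (pullback (h⁻¹).1 ω)
    rw [pullback_pullback, mul_inv_rev]
    rfl
  smul_zero g := by
    change pullback (g⁻¹).1 0 = 0
    apply Subtype.ext
    funext j
    simp [pullback]
  smul_add g ω η := by
    change pullback (g⁻¹).1 (ω + η) = pullback (g⁻¹).1 ω + pullback (g⁻¹).1 η
    apply Subtype.ext
    funext j
    simp [pullback, mul_add, Finset.sum_add_distrib]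

instance (d : ℕ) : SMulCommClass SL(3, ℂ) ℂ (Form d) where
  smul_comm g c ω := by
    change pullback (g⁻¹).1 (c • ω) = c • pullback (g⁻¹).1 ω
    apply Subtype.ext
    funext j
    simp [pullback, Finset.smul_sum]

/-! ### The space of foliations -/

/-- The projective space `𝓕_d` of 1-forms of degree `d + 1` up to nonzero scalars. A point is a
foliation of degree `d` when it also satisfies `NoCommonFactor`. -/
def FoliationSpace (d : ℕ) : Type := ℙ ℂ (Form d)

instance (d : ℕ) : TopologicalSpace (FoliationSpace d) := zariskiTopology (Form d)

instance (d : ℕ) : MulAction SL(3, ℂ) (FoliationSpace d) :=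
  inferInstanceAs (MulAction SL(3, ℂ) (ℙ ℂ (Form d)))

namespace FoliationSpace

variable {d : ℕ}

/-- A 1-form defining `F`; it is unique up to a nonzero scalar, on which none of the notions below
depends. -/
def form (F : FoliationSpace d) : Form d := Projectivization.rep F

/-- The coefficients of a 1-form defining `F` have no common factor. -/
def NoCommonFactor (F : FoliationSpace d) : Prop :=
  ∀ h : Poly3, (∀ i, h ∣ F.form.1 i) → IsUnit h

/-- The singular points of `F`: the points of the projective plane at which all coefficients
vanish. -/
def singularSet (F : FoliationSpace d) : Set (ℙ ℂ (Fin 3 → ℂ)) :=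
  {p | ∀ i, eval p.rep (F.form.1 i) = 0}

/-- The pencil `{α G - β H}`, `(α : β) ∈ ℙ¹`, defines a rational first integral of `F` of
degree `s`: `G`, `H` are homogeneous of degree `s` without common factor, all but finitely many
members of the pencil are irreducible, and `G dH - H dG = R ω` for some polynomial `R ≠ 0`, where
`ω` is a 1-form defining `F`. -/
def IsRationalFirstIntegral (F : FoliationSpace d) (s : ℕ) (G H : Poly3) : Prop :=
  G.IsHomogeneous s ∧ H.IsHomogeneous s ∧ IsRelPrime G H ∧
    {t : ℙ ℂ (Fin 2 → ℂ) | ¬ Irreducible (C (t.rep 0) * G - C (t.rep 1) * H)}.Finite ∧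
    ∃ R : Poly3, R ≠ 0 ∧ ∀ i, G * pderiv i H - H * pderiv i G = R * F.form.1 i

end FoliationSpace

/-! ### The family `P(y,z) ∂/∂x + z^d ∂/∂y` -/

/-- The polynomial `P(y,z)` as a polynomial in `x, y, z`. -/
def inYZ (P : MvPolynomial (Fin 2) ℂ) : Poly3 := rename ![1, 2] P

/-- The vector field `P(y,z) ∂/∂x + z^d ∂/∂y`, where `P` is homogeneous of degree `d`. -/
def normalField {d : ℕ} (P : MvPolynomial (Fin 2) ℂ) (hP : P.IsHomogeneous d) : VectorField d :=
  ⟨![inYZ P, X 2 ^ d, 0], fun i _ => by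
    change (_ : Poly3).IsHomogeneous d
    fin_cases i
    · exact hP.rename_isHomogeneous
    · exact isHomogeneous_X_pow 2 d
    · exact isHomogeneous_zero _ _ _⟩

theorem normalField_toForm_ne_zero {d : ℕ} (P : MvPolynomial (Fin 2) ℂ) (hP : P.IsHomogeneous d) :
    toForm (normalField P hP) ≠ 0 := by
  intro h
  have h0 := congrFun (congrArg Subtype.val h) 0
  simp [normalField, toForm, X_ne_zero] at h0

/-- The foliation defined by `P(y,z) ∂/∂x + z^d ∂/∂y`. -/
def normalFoliation {d : ℕ} (P : MvPolynomial (Fin 2) ℂ) (hP : P.IsHomogeneous d) :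
    FoliationSpace d :=
  Projectivization.mk ℂ (toForm (normalField P hP)) (normalField_toForm_ne_zero P hP)

/-- `P(y,0)`, as a polynomial in `y`. -/
def atZZero (P : MvPolynomial (Fin 2) ℂ) : Polynomial ℂ := aeval ![Polynomial.X, 0] P

/-- The `SL(3,ℂ)`-orbit of the set of foliations `P(y,z) ∂/∂x + z^d ∂/∂y` with `P` homogeneous of
degree `d` and `P(y,0) ≠ 0`. -/
def orbitFamily (d : ℕ) : Set (FoliationSpace d) :=
  {F | ∃ (P : MvPolynomial (Fin 2) ℂ) (hP : P.IsHomogeneous d), atZZero P ≠ 0 ∧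
    F ∈ MulAction.orbit SL(3, ℂ) (normalFoliation P hP)}

/-- The coefficient `a_i` of `y^i z^(d-i)` in `P(y,z)`. -/
def coeffYZ (d : ℕ) (P : MvPolynomial (Fin 2) ℂ) (i : ℕ) : ℂ :=
  P.coeff (Finsupp.single 0 i + Finsupp.single 1 (d - i))

/-- The polynomial `∑ i ≤ d, a_i / (i + 1) y^(i+1) z^(d-i) - x z^d`, where
`P = ∑ i ≤ d, a_i y^i z^(d-i)`. -/
def pencilG (d : ℕ) (P : MvPolynomial (Fin 2) ℂ) : Poly3 :=
  ∑ i ∈ Finset.range (d + 1), C (coeffYZ d P i / ((i : ℂ) + 1)) * X 1 ^ (i + 1) * X 2 ^ (d - i)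
    - X 0 * X 2 ^ d

end PlaneFoliation

end

noncomputable section

namespace PlaneFoliation

/-! ### Subalgebras of functions -/

section Functions

variable {Y : Type*} (𝒜 : Subalgebra ℂ (Y → ℂ))

/-! First integral. With G the first generator of the pencil, the normal form is ω = z dG − (d+1) G
dz (`normalForm_eq`), so H = z^(d+1) gives G dH − H dG = −z^d ω. A member of the pencil with α ≠ 0
has degree one in x, with leading coefficient −α z^d coprime to the rest, hence is irreducible.
Writing ω = A dx + B dy + C dz, the two facts A = −z^(d+1) and C(0,1,0) = −a_d ≠ 0 exclude a common
factor, and on z = 0 only (1:0:0) is singular. All of this is carried along by an invertible matrix.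

Irreducibility. The family is the image of the open set det M · a_d ≠ 0 in the affine space of pairs
(M, P) under a polynomial map. Allowing every invertible M instead of determinant one changes
nothing, since scalar matrices only rescale forms (`mk_mem_orbitFamily`).

Local closedness and dimension. Both can be checked on one open set whose translates cover the
family. There a form, scaled so that its dx-coefficient at (0:0:1) is −1, is brought by four
successive shears to a form satisfying `IsReduced`; the shear parameters are regular functions of
the point. The crux is `exists_eq_normalFormOf`: a reduced form equivalent to a normal form is
itself a normal form, with a_0 = 0 and a_d ≠ 0. Hence membership in the family is a closed condition
on the open set, and the four parameters together with a_1, …, a_d are a chart onto {a_d ≠ 0} in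
ℂ^(d+4).

The Krull dimension of a set with such a chart is bounded above by embedding the set in the spectrum
of a polynomial ring, and below by a flag of coordinate subspaces. -/

theorem eval_mem_of_mem {κ : Type*} {f : κ → Y → ℂ} (hf : ∀ k, f k ∈ 𝒜) (p : MvPolynomial κ ℂ) :
    (fun y => eval (fun k => f k y) p) ∈ 𝒜 := by
  induction p using MvPolynomial.induction_on with
  | C a => simp only [eval_C]; exact 𝒜.algebraMap_mem a
  | add p q hp hq => simp only [map_add]; exact 𝒜.add_mem hp hq
  | mul_X p i hp => simp only [map_mul, eval_X]; exact 𝒜.mul_mem hp (hf i)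

/-- The polynomial functions on the affine space `ι → ℂ`. -/
def polyFunctions (ι : Type*) : Subalgebra ℂ ((ι → ℂ) → ℂ) where
  carrier := {f | ∃ p : MvPolynomial ι ℂ, ∀ a, f a = eval a p}
  mul_mem' := by
    rintro f g ⟨p, hp⟩ ⟨q, hq⟩
    exact ⟨p * q, fun a => by simp [hp, hq]⟩
  add_mem' := by
    rintro f g ⟨p, hp⟩ ⟨q, hq⟩
    exact ⟨p + q, fun a => by simp [hp, hq]⟩
  algebraMap_mem' r := ⟨C r, fun a => by simp⟩

theorem coord_mem_polyFunctions {ι : Type*} (i : ι) :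
    (fun a : ι → ℂ => a i) ∈ polyFunctions ι := ⟨X i, fun a => by simp⟩

end Functions

theorem eval_smul_of_isHomogeneous {κ : Type*} {p : MvPolynomial κ ℂ} {n : ℕ}
    (hp : p.IsHomogeneous n) (c : ℂ) (v : κ → ℂ) : eval (c • v) p = c ^ n * eval v p := by
  rw [eval_eq, eval_eq, Finset.mul_sum]
  refine Finset.sum_congr rfl fun m hm => ?_
  have hm' : m.degree = n := by
    rw [Finsupp.degree_eq_weight_one]
    exact hp (mem_support_iff.mp hm)
  simp only [Pi.smul_apply, smul_eq_mul, mul_pow, Finset.prod_mul_distrib,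
    Finset.prod_pow_eq_pow_sum]
  rw [← hm', Finsupp.degree]
  ring_nf
  rfl

/-- Open sets of `X` are preimages of open sets of `Y`, so a common point of two of them can be
looked for in the image. -/
theorem isIrreducible_of_image_of_isInducing {X Y : Type*} [TopologicalSpace X]
    [TopologicalSpace Y] {f : X → Y} (hf : Topology.IsInducing f) {s : Set X}
    (hs : IsIrreducible (f '' s)) : IsIrreducible s := by
  refine ⟨Set.image_nonempty.1 hs.1, ?_⟩
  intro u v hu hv hsu hsv
  obtain ⟨u, hu', rfl⟩ := hf.isOpen_iff.1 hu
  obtain ⟨v, hv', rfl⟩ := hf.isOpen_iff.1 hv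
  obtain ⟨x, hx, hxu⟩ := hsu
  obtain ⟨y, hy, hyv⟩ := hsv
  obtain ⟨_, ⟨z, hz, rfl⟩, hzu, hzv⟩ := hs.2 u v hu' hv' ⟨f x, ⟨x, hx, rfl⟩, hxu⟩
    ⟨f y, ⟨y, hy, rfl⟩, hyv⟩
  exact ⟨z, hz, hzu, hzv⟩

/-! ### Regular functions on subsets of a projective space -/

section Projective

variable {V : Type*} [AddCommGroup V] [Module ℂ V]

attribute [local instance] zariskiTopology

theorem evalAt_smul {p : PolyFun V} {n : ℕ} (hp : p.IsHomogeneous n) (c : ℂ) (v : V) :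
    evalAt (c • v) p = c ^ n * evalAt v p := by
  have : (fun φ : Module.Dual ℂ V => φ (c • v)) = c • fun φ : Module.Dual ℂ V => φ v := by
    ext φ; simp
  simp only [evalAt]
  rw [this, eval_smul_of_isHomogeneous hp]

/-- The functions on a projective space that agree on `O` with a quotient of two homogeneous
polynomials of the same degree, the denominator having no zero in `O`. -/
def regularFunctions (O : Set (ℙ ℂ V)) : Subalgebra ℂ (ℙ ℂ V → ℂ) where
  carrier := {f | ∃ (n : ℕ) (N D : PolyFun V), N.IsHomogeneous n ∧ D.IsHomogeneous n ∧
    ∀ x ∈ O, evalAt x.rep D ≠ 0 ∧ f x * evalAt x.rep D = evalAt x.rep N}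
  mul_mem' := by
    rintro f g ⟨n, N, D, hN, hD, h⟩ ⟨n', N', D', hN', hD', h'⟩
    refine ⟨n + n', N * N', D * D', hN.mul hN', hD.mul hD', fun x hx => ?_⟩
    obtain ⟨h1, h2⟩ := h x hx
    obtain ⟨h1', h2'⟩ := h' x hx
    simp only [evalAt, map_mul] at *
    refine ⟨mul_ne_zero h1 h1', ?_⟩
    rw [← h2, ← h2']
    simp only [Pi.mul_apply]
    ring
  add_mem' := by
    rintro f g ⟨n, N, D, hN, hD, h⟩ ⟨n', N', D', hN', hD', h'⟩
    refine ⟨n + n', N * D' + D * N', D * D', (hN.mul hD').add (hD.mul hN'), hD.mul hD',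
      fun x hx => ?_⟩
    obtain ⟨h1, h2⟩ := h x hx
    obtain ⟨h1', h2'⟩ := h' x hx
    simp only [evalAt, map_mul, map_add] at *
    refine ⟨mul_ne_zero h1 h1', ?_⟩
    rw [← h2, ← h2']
    simp only [Pi.add_apply]
    ring
  algebraMap_mem' r := ⟨0, C r, 1, isHomogeneous_C _ _, isHomogeneous_one _ _,
    fun x _ => by simp [evalAt]⟩

variable {O : Set (ℙ ℂ V)}

theorem regularFunctions_mono {O' : Set (ℙ ℂ V)} (h : O' ⊆ O) {f : ℙ ℂ V → ℂ}
    (hf : f ∈ regularFunctions O) : f ∈ regularFunctions O' := by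
  obtain ⟨n, N, D, hN, hD, hx⟩ := hf
  exact ⟨n, N, D, hN, hD, fun x hx' => hx x (h hx')⟩

theorem div_mem_regularFunctions {f g : ℙ ℂ V → ℂ} (hf : f ∈ regularFunctions O)
    (hg : g ∈ regularFunctions O) (h0 : ∀ x ∈ O, g x ≠ 0) :
    (fun x => f x / g x) ∈ regularFunctions O := by
  obtain ⟨n, N, D, hN, hD, h⟩ := hf
  obtain ⟨n', N', D', hN', hD', h'⟩ := hg
  refine ⟨n + n', N * D', D * N', hN.mul hD', hD.mul hN', fun x hx => ?_⟩
  obtain ⟨h1, h2⟩ := h x hx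
  obtain ⟨h1', h2'⟩ := h' x hx
  have h0 := h0 x hx
  simp only [evalAt, map_mul] at *
  rw [← h2, ← h2']
  refine ⟨mul_ne_zero h1 (mul_ne_zero h0 h1'), ?_⟩
  field_simp

theorem linear_div_mem_regularFunctions (φ θ : Module.Dual ℂ V) (h0 : ∀ x ∈ O, θ x.rep ≠ 0) :
    (fun x => φ x.rep / θ x.rep) ∈ regularFunctions O := by
  refine ⟨1, X φ, X θ, isHomogeneous_X _ _, isHomogeneous_X _ _, fun x hx => ?_⟩
  have := h0 x hx
  simp only [evalAt, eval_X]
  exact ⟨this, div_mul_cancel₀ _ this⟩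

theorem isClosed_zeroLocus {S : Set (PolyFun V)} (hS : ∀ p ∈ S, ∃ n, p.IsHomogeneous n) :
    IsClosed (zeroLocus S) := by
  have : IsZariskiClosed (zeroLocus S) := ⟨S, hS, rfl⟩
  rw [← isOpen_compl_iff]
  simpa [IsOpen, TopologicalSpace.IsOpen, zariskiTopology, TopologicalSpace.ofClosed] using this

theorem exists_zeroLocus_of_isClosed {Z : Set (ℙ ℂ V)} (hZ : IsClosed Z) :
    ∃ S : Set (PolyFun V), (∀ p ∈ S, ∃ n, p.IsHomogeneous n) ∧ Z = zeroLocus S := by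
  rw [← isOpen_compl_iff] at hZ
  have : IsZariskiClosed Z := by
    simpa [IsOpen, TopologicalSpace.IsOpen, zariskiTopology, TopologicalSpace.ofClosed] using hZ
  exact this

/-- On `O` the denominator does not vanish, so the zeros there are those of the numerator. -/
theorem exists_isClosed_of_mem_regularFunctions {f : ℙ ℂ V → ℂ} (hf : f ∈ regularFunctions O) :
    ∃ Z : Set (ℙ ℂ V), IsClosed Z ∧ ∀ x ∈ O, f x = 0 ↔ x ∈ Z := by
  obtain ⟨n, N, D, hN, hD, h⟩ := hf
  refine ⟨zeroLocus {N}, isClosed_zeroLocus (by rintro p rfl; exact ⟨n, hN⟩), fun x hx => ?_⟩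
  obtain ⟨h1, h2⟩ := h x hx
  simp only [zeroLocus, Set.mem_singleton_iff, forall_eq, Set.mem_ofPred_eq, ← h2, mul_eq_zero, h1,
    or_false]

theorem exists_isClosed_forall {κ : Type*} {f : κ → ℙ ℂ V → ℂ}
    (hf : ∀ k, f k ∈ regularFunctions O) :
    ∃ Z : Set (ℙ ℂ V), IsClosed Z ∧ ∀ x ∈ O, (∀ k, f k x = 0) ↔ x ∈ Z := by
  choose Z hZ h using fun k => exists_isClosed_of_mem_regularFunctions (hf k)
  refine ⟨⋂ k, Z k, isClosed_iInter hZ, fun x hx => ?_⟩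
  simp only [Set.mem_iInter]
  exact forall_congr' fun k => h k x hx

theorem isOpen_ne_zero_of_mem_regularFunctions (hO : IsOpen O) {f : ℙ ℂ V → ℂ}
    (hf : f ∈ regularFunctions O) : IsOpen {x | x ∈ O ∧ f x ≠ 0} := by
  obtain ⟨Z, hZ, h⟩ := exists_isClosed_of_mem_regularFunctions hf
  have : {x | x ∈ O ∧ f x ≠ 0} = O ∩ Zᶜ := by
    ext x
    constructor
    · rintro ⟨h1, h2⟩
      exact ⟨h1, fun h3 => h2 ((h x h1).2 h3)⟩
    · rintro ⟨h1, h2⟩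
      exact ⟨h1, fun h3 => h2 ((h x h1).1 h3)⟩
  rw [this]
  exact hO.inter hZ.isOpen_compl

theorem isOpen_linear_ne_zero (θ : Module.Dual ℂ V) : IsOpen {x : ℙ ℂ V | θ x.rep ≠ 0} := by
  have : {x : ℙ ℂ V | θ x.rep ≠ 0} = (zeroLocus {(X θ : PolyFun V)})ᶜ := by
    ext x
    simp [zeroLocus, evalAt]
  rw [this]
  exact (isClosed_zeroLocus (by rintro p rfl; exact ⟨1, isHomogeneous_X _ _⟩)).isOpen_compl

theorem mem_zeroLocus_mk {S : Set (PolyFun V)} (hS : ∀ p ∈ S, ∃ n, p.IsHomogeneous n) {v : V}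
    (hv : v ≠ 0) : Projectivization.mk ℂ v hv ∈ zeroLocus S ↔ ∀ p ∈ S, evalAt v p = 0 := by
  obtain ⟨c, hc⟩ := Projectivization.exists_smul_eq_mk_rep ℂ v hv
  have hc' : (Projectivization.mk ℂ v hv).rep = (c : ℂ) • v := hc.symm
  refine forall₂_congr fun p hp => ?_
  obtain ⟨n, hn⟩ := hS p hp
  rw [hc', evalAt_smul hn, mul_eq_zero, or_iff_right (pow_ne_zero _ c.ne_zero)]

/-- The preimage of a zero locus is cut out by the polynomials p ∘ f, obtained by replacing each
linear form φ with φ ∘ f; homogeneity absorbs the scalar c. -/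
theorem continuous_of_rep_eq_smul (f : V →ₗ[ℂ] V) (F : ℙ ℂ V → ℙ ℂ V)
    (h : ∀ x, ∃ c : ℂ, c ≠ 0 ∧ (F x).rep = c • f x.rep) : Continuous F := by
  rw [continuous_iff_isClosed]
  intro Z hZ
  obtain ⟨S, hS, rfl⟩ := exists_zeroLocus_of_isClosed hZ
  have : F ⁻¹' zeroLocus S =
      zeroLocus ((rename (fun φ : Module.Dual ℂ V => φ.comp f)) '' S) := by
    ext x
    obtain ⟨c, hc, hx⟩ := h x
    simp only [zeroLocus, Set.mem_preimage, Set.mem_ofPred_eq, Set.forall_mem_image]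
    refine forall₂_congr fun p hp => ?_
    obtain ⟨n, hn⟩ := hS p hp
    rw [hx, evalAt_smul hn, mul_eq_zero, or_iff_right (pow_ne_zero _ hc)]
    simp [evalAt, eval_rename, Function.comp_def]
  rw [this]
  refine isClosed_zeroLocus ?_
  rintro _ ⟨p, hp, rfl⟩
  obtain ⟨n, hn⟩ := hS p hp
  exact ⟨n, hn.rename_isHomogeneous⟩

/-! ### Polynomial parametrizations, charts and Krull dimension -/

/-- The image in `ℙ(V)` of a nonempty basic open subset of an affine space under a polynomial map
is irreducible. -/
theorem isIrreducible_image {ι : Type*} (ψ : (ι → ℂ) → V)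
    (hψ : ∀ φ : Module.Dual ℂ V, (fun a => φ (ψ a)) ∈ polyFunctions ι) (h : MvPolynomial ι ℂ)
    (h0 : h ≠ 0) (hv : ∀ a, eval a h ≠ 0 → ψ a ≠ 0) :
    IsIrreducible {x : ℙ ℂ V | ∃ (a : ι → ℂ) (ha : eval a h ≠ 0),
      x = Projectivization.mk ℂ (ψ a) (hv a ha)} := by
  have exists_ne : ∀ p : MvPolynomial ι ℂ, p ≠ 0 → ∃ a, eval a p ≠ 0 := fun p hp => by
    by_contra! hc
    exact hp (MvPolynomial.funext fun a => by simpa using hc a)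
  constructor
  · obtain ⟨a, ha⟩ := exists_ne h h0
    exact ⟨_, a, ha, rfl⟩
  rw [isPreirreducible_iff_isClosed_union_isClosed]
  intro Z₁ Z₂ hZ₁ hZ₂ hsub
  obtain ⟨S₁, hS₁, rfl⟩ := exists_zeroLocus_of_isClosed hZ₁
  obtain ⟨S₂, hS₂, rfl⟩ := exists_zeroLocus_of_isClosed hZ₂
  by_contra hc
  obtain ⟨hc1, hc2⟩ := not_or.mp hc
  -- A closed set that misses a point of the image has an equation whose pullback by ψ is a nonzero
  -- polynomial. The product of h with two such pullbacks is nonzero somewhere, which gives a point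
  -- of the image outside both closed sets.
  have key : ∀ S : Set (PolyFun V), (∀ p ∈ S, ∃ n, p.IsHomogeneous n) →
      ¬ {x : ℙ ℂ V | ∃ (a : ι → ℂ) (ha : eval a h ≠ 0),
        x = Projectivization.mk ℂ (ψ a) (hv a ha)} ⊆ zeroLocus S →
      ∃ p ∈ S, ∃ q : MvPolynomial ι ℂ, q ≠ 0 ∧ ∀ a, evalAt (ψ a) p = eval a q := by
    intro S hS hn
    obtain ⟨_, ⟨a, ha, rfl⟩, hx⟩ := Set.not_subset.mp hn
    rw [mem_zeroLocus_mk hS] at hx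
    push Not at hx
    obtain ⟨p, hp, hpa⟩ := hx
    obtain ⟨q, hq⟩ := eval_mem_of_mem (polyFunctions ι) hψ p
    refine ⟨p, hp, q, ?_, hq⟩
    rintro rfl
    exact hpa ((hq a).trans (map_zero _))
  obtain ⟨p₁, hp₁, q₁, hq₁, h₁⟩ := key S₁ hS₁ hc1
  obtain ⟨p₂, hp₂, q₂, hq₂, h₂⟩ := key S₂ hS₂ hc2
  obtain ⟨a, ha⟩ := exists_ne (h * (q₁ * q₂)) (mul_ne_zero h0 (mul_ne_zero hq₁ hq₂))
  simp only [map_mul, mul_ne_zero_iff] at ha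
  rcases hsub ⟨a, ha.1, rfl⟩ with hx | hx
  · rw [mem_zeroLocus_mk hS₁] at hx
    exact ha.2.1 ((h₁ a).symm.trans (hx p₁ hp₁))
  · rw [mem_zeroLocus_mk hS₂] at hx
    exact ha.2.2 ((h₂ a).symm.trans (hx p₂ hp₂))

/-- The coordinates induce the topology of `T` from the prime spectrum of ℂ[ι]: homogeneous
equations become polynomial equations in the coordinates through ψ, and polynomial equations in the
regular functions χ are closed conditions on `O`. -/
theorem topologicalKrullDim_le_of_chart {ι : Type*} [Fintype ι] {T : Set (ℙ ℂ V)} (hTO : T ⊆ O)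
    (χ : ℙ ℂ V → ι → ℂ) (hχ : ∀ i, (fun x => χ x i) ∈ regularFunctions O) (ψ : (ι → ℂ) → V)
    (hψ : ∀ φ : Module.Dual ℂ V, (fun a => φ (ψ a)) ∈ polyFunctions ι)
    (hT : ∀ x ∈ T, ∃ hv : ψ (χ x) ≠ 0, x = Projectivization.mk ℂ (ψ (χ x)) hv) :
    topologicalKrullDim T ≤ Fintype.card ι := by
  let f : T → PrimeSpectrum (MvPolynomial ι ℂ) := fun x => pointToPoint (χ x)
  have hf : ∀ (x : T) (S : Set (MvPolynomial ι ℂ)),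
      f x ∈ PrimeSpectrum.zeroLocus S ↔ ∀ p ∈ S, eval (χ x) p = 0 := by
    intro x S
    simp only [f, PrimeSpectrum.mem_zeroLocus, pointToPoint]
    refine forall₂_congr fun p hp => ?_
    simp [aeval_eq_eval]
  have hind : Topology.IsInducing f := by
    refine ⟨TopologicalSpace.ext_isClosed fun Z => ?_⟩
    rw [isClosed_induced_iff, isClosed_induced_iff]
    constructor
    · rintro ⟨Z, hZ, rfl⟩
      obtain ⟨S, hS, rfl⟩ := exists_zeroLocus_of_isClosed hZ
      choose q hq using fun p => eval_mem_of_mem (polyFunctions ι) hψ p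
      refine ⟨PrimeSpectrum.zeroLocus (q '' S), PrimeSpectrum.isClosed_zeroLocus _, ?_⟩
      ext x
      obtain ⟨hv, hx⟩ := hT x x.2
      have hmem : (x : ℙ ℂ V) ∈ zeroLocus S ↔ ∀ p ∈ S, evalAt (ψ (χ x)) p = 0 := by
        rw [← mem_zeroLocus_mk hS hv, ← hx]
      rw [Set.mem_preimage, hf, Set.forall_mem_image, Set.mem_preimage, hmem]
      exact forall₂_congr fun p hp => by rw [← hq]; rfl
    · rintro ⟨Z, hZ, rfl⟩
      obtain ⟨S, rfl⟩ := (PrimeSpectrum.isClosed_iff_zeroLocus Z).1 hZ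
      obtain ⟨Z, hZ, hZ'⟩ := exists_isClosed_forall (O := O)
        fun p : S => eval_mem_of_mem (regularFunctions O) hχ p.1
      refine ⟨Z, hZ, ?_⟩
      ext x
      rw [Set.mem_preimage, Set.mem_preimage, hf, ← hZ' x (hTO x.2)]
      exact Subtype.forall
  calc topologicalKrullDim T ≤ topologicalKrullDim (PrimeSpectrum (MvPolynomial ι ℂ)) :=
        hind.topologicalKrullDim_le
    _ = Fintype.card ι := by
        rw [PrimeSpectrum.topologicalKrullDim_eq_ringKrullDim,
          MvPolynomial.ringKrullDim_of_isNoetherianRing, ringKrullDim_eq_zero_of_field]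
        simp

/-- Intersecting with a flag of coordinate subspaces through a point b with h(b) ≠ 0 gives a strict
chain of irreducible closed sets. Each is irreducible as the image of a nonempty basic open set
under a polynomial map. -/
theorem le_topologicalKrullDim_of_chart {ι : Type*} [Fintype ι] {T : Set (ℙ ℂ V)} (hTO : T ⊆ O)
    (χ : ℙ ℂ V → ι → ℂ) (hχ : ∀ i, (fun x => χ x i) ∈ regularFunctions O) (ψ : (ι → ℂ) → V)
    (hψ : ∀ φ : Module.Dual ℂ V, (fun a => φ (ψ a)) ∈ polyFunctions ι)
    (h : MvPolynomial ι ℂ) (h0 : h ≠ 0)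
    (hT : ∀ x ∈ T, eval (χ x) h ≠ 0 ∧
      ∃ hv : ψ (χ x) ≠ 0, x = Projectivization.mk ℂ (ψ (χ x)) hv)
    (hψT : ∀ a, eval a h ≠ 0 → ∃ hv : ψ a ≠ 0, Projectivization.mk ℂ (ψ a) hv ∈ T ∧
      χ (Projectivization.mk ℂ (ψ a) hv) = a) :
    Fintype.card ι ≤ topologicalKrullDim T := by
  classical
  have exists_ne : ∀ p : MvPolynomial ι ℂ, p ≠ 0 → ∃ a, eval a p ≠ 0 := fun p hp => by
    by_contra! hc
    exact hp (MvPolynomial.funext fun a => by simpa using hc a)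
  obtain ⟨b, hb⟩ := exists_ne h h0
  let e := Fintype.equivFin ι
  -- `L k` freezes the coordinates from index k on at their values in b, and `l k` is the same
  -- substitution on polynomials. Since `L k b = b`, the restriction `l k h` remains nonzero.
  let L : ℕ → (ι → ℂ) → ι → ℂ := fun k a i => if (e i : ℕ) < k then a i else b i
  let l : ℕ → MvPolynomial ι ℂ →ₐ[ℂ] MvPolynomial ι ℂ := fun k =>
    aeval fun i => if (e i : ℕ) < k then X i else C (b i)
  have hl : ∀ k p a, eval a (l k p) = eval (L k a) p := by
    intro k p a
    have : (eval a).comp (l k : MvPolynomial ι ℂ →+* MvPolynomial ι ℂ) = eval (L k a) := by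
      apply MvPolynomial.ringHom_ext
      · intro r
        simp [l, algebraMap_eq]
      · intro i
        simp only [RingHom.comp_apply, l, RingHom.coe_coe, aeval_X, L, eval_X]
        split_ifs <;> simp
    exact DFunLike.congr_fun this p
  have hLb : ∀ k, L k b = b := fun k => by
    ext i
    simp [L]
  have hl0 : ∀ k, l k h ≠ 0 := fun k hk => by
    have := hl k h b
    rw [hk, hLb] at this
    exact hb (by simpa using this.symm)
  let F : ℕ → Set T := fun k => {x | ∀ i, k ≤ (e i : ℕ) → χ x i = b i}
  have hFmem : ∀ k (x : T), x ∈ F k ↔ L k (χ x) = χ x := by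
    intro k x
    simp only [F, L, Set.mem_ofPred_eq, _root_.funext_iff]
    refine forall_congr' fun i => ?_
    split_ifs with hi
    · simp [hi]
    · simp only [not_lt.mp hi, true_imp_iff]
      exact eq_comm
  have hFclosed : ∀ k, IsClosed (F k) := by
    intro k
    obtain ⟨Z, hZ, hZ'⟩ := exists_isClosed_forall (O := O)
      (f := fun (i : {i // k ≤ (e i : ℕ)}) x => χ x i - b i) fun i =>
        (regularFunctions O).sub_mem (hχ i) ((regularFunctions O).algebraMap_mem (b i))
    convert hZ.preimage continuous_subtype_val using 1
    ext x
    rw [Set.mem_preimage, ← hZ' x (hTO x.2)]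
    simp only [F, Set.mem_ofPred_eq, sub_eq_zero, Subtype.forall]
  have hFirr : ∀ k, IsIrreducible (F k) := by
    intro k
    have hv : ∀ a, eval a (l k h) ≠ 0 → ψ (L k a) ≠ 0 := fun a ha => (hψT _ (hl k h a ▸ ha)).1
    have himg := isIrreducible_image (fun a => ψ (L k a)) (fun φ => by
      obtain ⟨q, hq⟩ := hψ φ
      exact ⟨l k q, fun a => by rw [hl]; exact hq _⟩) (l k h) (hl0 k) hv
    have heq : Subtype.val '' F k = {x : ℙ ℂ V | ∃ (a : ι → ℂ) (ha : eval a (l k h) ≠ 0),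
        x = Projectivization.mk ℂ (ψ (L k a)) (hv a ha)} := by
      ext x
      constructor
      · rintro ⟨x, hx, rfl⟩
        rw [hFmem] at hx
        obtain ⟨h1, hv', h2⟩ := hT x x.2
        refine ⟨χ x, by rwa [hl, hx], ?_⟩
        simp only [hx]
        exact h2
      · rintro ⟨a, ha, rfl⟩
        obtain ⟨hv', h1, h2⟩ := hψT (L k a) (hl k h a ▸ ha)
        refine ⟨⟨_, h1⟩, ?_, rfl⟩
        rw [hFmem, h2]
        ext i
        simp only [L]
        split_ifs <;> rfl
    rw [← heq] at himg
    exact isIrreducible_of_image_of_isInducing Topology.IsInducing.subtypeVal himg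
  have hFmono : ∀ k (hk : k < Fintype.card ι), F k ⊂ F (k + 1) := by
    intro k hk
    refine ⟨fun x hx i hi => hx i (by omega), fun hsub => ?_⟩
    let i : ι := e.symm ⟨k, hk⟩
    have hi : (e i : ℕ) = k := by simp [i]
    have hne : (X i - C (b i) : MvPolynomial ι ℂ) ≠ 0 := fun h0 => by
      have := congrArg (eval fun _ => b i + 1) h0
      simp at this
    -- Such an a gives a point of `F (k + 1)` whose coordinate of index k differs from that of b, so
    -- it is not in `F k`.
    obtain ⟨a, ha⟩ := exists_ne _ (mul_ne_zero (hl0 (k + 1)) hne)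
    simp only [map_mul, map_sub, eval_X, eval_C, mul_ne_zero_iff, hl, sub_ne_zero] at ha
    obtain ⟨hv', h1, h2⟩ := hψT _ ha.1
    have hmem : (⟨_, h1⟩ : T) ∈ F (k + 1) := by
      rw [hFmem, h2]
      ext j
      simp only [L]
      split_ifs <;> rfl
    have := hsub hmem i hi.ge
    rw [h2] at this
    simp only [L, hi, Nat.lt_succ_self, if_true] at this
    exact ha.2 this
  let s : LTSeries (TopologicalSpace.IrreducibleCloseds T) :=
    { length := Fintype.card ι
      toFun := fun k => ⟨F k, hFirr k, hFclosed k⟩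
      step := fun k => hFmono k k.2 }
  exact Order.LTSeries.length_le_krullDim s

end Projective

/-! ### Local properties and translates under a group -/

/-- A set is as large as an open part of it whose translates cover it. -/
theorem topologicalKrullDim_eq_of_translates {X G : Type*} [TopologicalSpace X] [Group G]
    [MulAction G X] (hc : ∀ g : G, Continuous fun x : X => g • x) {S O : Set X} (hO : IsOpen O)
    (hS : ∀ (g : G), ∀ x ∈ S, g • x ∈ S) (hcov : ∀ x ∈ S, ∃ g : G, g • x ∈ O) :
    topologicalKrullDim S = topologicalKrullDim (S ∩ O : Set X) := by
  apply le_antisymm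
  · refine iSup_le fun s => ?_
    -- A point of the smallest member lies in every member of the chain. After translation by g the
    -- whole chain meets the open set, and restricting irreducible closed sets to an open set they
    -- all meet preserves strict inclusions.
    obtain ⟨x, hx⟩ := (s 0).isIrreducible.nonempty
    obtain ⟨g, hg⟩ := hcov x x.2
    let U : Set S := {y | g • (y : X) ∈ O}
    have hU : IsOpen U := hO.preimage ((hc g).comp continuous_subtype_val)
    let f : U → (S ∩ O : Set X) := fun y => ⟨g • (y : X), hS g _ y.1.2, y.2⟩
    have hf : Topology.IsInducing f := by
      have h1 : Topology.IsInducing fun x : X => g • x :=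
        (Homeomorph.mk (MulAction.toPerm g) (hc g) (hc g⁻¹)).isInducing
      have h2 : Topology.IsInducing (Subtype.val ∘ f) :=
        h1.comp (Topology.IsInducing.subtypeVal.comp Topology.IsInducing.subtypeVal)
      exact Topology.IsInducing.of_comp_iff Topology.IsInducing.subtypeVal |>.1 h2
    refine le_trans ?_ hf.topologicalKrullDim_le
    have hne : ∀ i, (Subtype.val ⁻¹' (s i : Set S) : Set U).Nonempty := fun i =>
      ⟨⟨x, hg⟩, (s.monotone (Fin.zero_le i) : s 0 ≤ s i) hx⟩
    let emb := TopologicalSpace.IrreducibleCloseds.orderIsoOfIsOpenEmbedding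
      (Subtype.val : U → S) hU.isOpenEmbedding_subtypeVal
    let t : LTSeries (TopologicalSpace.IrreducibleCloseds U) :=
      { length := s.length
        toFun := fun i => emb.symm ⟨s i, hne i⟩
        step := fun i => emb.symm.strictMono (s.step i) }
    exact Order.LTSeries.length_le_krullDim t
  · exact (Topology.IsInducing.subtypeVal.of_comp_iff.1 (show Topology.IsInducing (Subtype.val ∘
      Set.inclusion (Set.inter_subset_left : S ∩ O ⊆ S)) from
        Topology.IsInducing.subtypeVal)).topologicalKrullDim_le

/-- A set is locally closed if an open set whose translates cover it meets it in a relatively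
closed subset. -/
theorem isLocallyClosed_of_translates {X G : Type*} [TopologicalSpace X] [Group G]
    [MulAction G X] (hc : ∀ g : G, Continuous fun x : X => g • x) {S O Z : Set X} (hO : IsOpen O)
    (hS : ∀ (g : G), ∀ x ∈ S, g • x ∈ S) (hcov : ∀ x ∈ S, ∃ g : G, g • x ∈ O) (hZ : IsClosed Z)
    (hZO : ∀ x ∈ O, x ∈ S ↔ x ∈ Z) : IsLocallyClosed S := by
  refine ((isLocallyClosed_tfae S).out 0 2).2 fun x hx => ?_
  obtain ⟨g, hg⟩ := hcov x hx
  have hU : IsOpen ((fun x : X => g • x) ⁻¹' O) := hO.preimage (hc g)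
  refine ⟨_, hU.mem_nhds hg, ?_⟩
  convert (hZ.preimage (hc g)).preimage continuous_subtype_val using 1
  ext y
  simp only [Set.mem_preimage]
  rw [← hZO _ y.2]
  exact ⟨hS g _, fun h => by simpa using hS g⁻¹ _ h⟩

/-! ### Families of polynomials and of forms -/

section Families

variable {Y : Type*}

/-- The coefficients of the polynomials `F y` belong to the algebra `𝒜` of functions of `y`. -/
def CoeffsIn (𝒜 : Subalgebra ℂ (Y → ℂ)) (F : Y → Poly3) : Prop :=
  ∀ m, (fun y => coeff m (F y)) ∈ 𝒜

variable {𝒜 : Subalgebra ℂ (Y → ℂ)}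

theorem fun_sum_mem {κ : Type*} (s : Finset κ) {f : κ → Y → ℂ} (hf : ∀ k ∈ s, f k ∈ 𝒜) :
    (fun y => ∑ k ∈ s, f k y) ∈ 𝒜 := by
  have : (fun y => ∑ k ∈ s, f k y) = ∑ k ∈ s, f k := by
    ext y; simp
  rw [this]
  exact 𝒜.sum_mem hf

namespace CoeffsIn

theorem const (p : Poly3) : CoeffsIn 𝒜 fun _ => p := fun m => 𝒜.algebraMap_mem (coeff m p)

theorem C {f : Y → ℂ} (hf : f ∈ 𝒜) : CoeffsIn 𝒜 fun y => MvPolynomial.C (f y) := fun m => by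
  simp only [coeff_C]
  split_ifs
  · exact hf
  · exact 𝒜.zero_mem

theorem sub {F G : Y → Poly3} (hF : CoeffsIn 𝒜 F) (hG : CoeffsIn 𝒜 G) :
    CoeffsIn 𝒜 fun y => F y - G y := fun m => by
  simp only [coeff_sub]
  exact 𝒜.sub_mem (hF m) (hG m)

theorem mul {F G : Y → Poly3} (hF : CoeffsIn 𝒜 F) (hG : CoeffsIn 𝒜 G) :
    CoeffsIn 𝒜 fun y => F y * G y := fun m => by
  simp only [coeff_mul]
  exact fun_sum_mem _ fun k _ => 𝒜.mul_mem (hF k.1) (hG k.2)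

theorem pow {F : Y → Poly3} (hF : CoeffsIn 𝒜 F) (n : ℕ) : CoeffsIn 𝒜 fun y => F y ^ n := by
  induction n with
  | zero => simpa using const 1
  | succ n ih => simpa only [pow_succ] using ih.mul hF

theorem sum {κ : Type*} (s : Finset κ) {F : κ → Y → Poly3} (hF : ∀ k ∈ s, CoeffsIn 𝒜 (F k)) :
    CoeffsIn 𝒜 fun y => ∑ k ∈ s, F k y := fun m => by
  simp only [coeff_sum]
  exact fun_sum_mem _ fun k hk => hF k hk m

theorem prod {κ : Type*} (s : Finset κ) {F : κ → Y → Poly3} (hF : ∀ k ∈ s, CoeffsIn 𝒜 (F k)) :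
    CoeffsIn 𝒜 fun y => ∏ k ∈ s, F k y := by
  classical
  induction s using Finset.induction_on with
  | empty => simpa using const 1
  | insert k s hk ih =>
    simp only [Finset.prod_insert hk]
    exact (hF k (Finset.mem_insert_self k s)).mul
      (ih fun j hj => hF j (Finset.mem_insert_of_mem hj))

end CoeffsIn

theorem eq_sum_of_isHomogeneous {F : Poly3} {n : ℕ} (hF : F.IsHomogeneous n) :
    F = ∑ m ∈ Finset.univ.finsuppAntidiag n, coeff m F • monomial m 1 := by
  ext k
  simp only [coeff_sum, coeff_smul, coeff_monomial, smul_eq_mul, mul_ite, mul_one, mul_zero,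
    Finset.sum_ite_eq']
  split_ifs with h
  · rfl
  · by_contra hk
    refine h ?_
    rw [Finset.mem_finsuppAntidiag]
    have : k.degree = n := by
      rw [Finsupp.degree_eq_weight_one]
      exact hF hk
    rw [Finsupp.degree_eq_sum] at this
    exact ⟨this, Finset.subset_univ _⟩

/-- A fixed degree bounds the monomials uniformly in y, so the value is a finite combination of
coefficients with constant weights. -/
theorem CoeffsIn.linear_mem {F : Y → Poly3} {n : ℕ} (hF : CoeffsIn 𝒜 F)
    (hn : ∀ y, (F y).IsHomogeneous n) (L : Poly3 →ₗ[ℂ] ℂ) : (fun y => L (F y)) ∈ 𝒜 := by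
  have : (fun y => L (F y)) = fun y => ∑ m ∈ Finset.univ.finsuppAntidiag n,
      coeff m (F y) * L (monomial m 1) := by
    ext y
    conv_lhs => rw [eq_sum_of_isHomogeneous (hn y)]
    simp
  rw [this]
  exact fun_sum_mem _ fun m _ => 𝒜.mul_mem (hF m) (𝒜.algebraMap_mem (L (monomial m 1)))

theorem CoeffsIn.comp {F : Y → Poly3} {n : ℕ} (hF : CoeffsIn 𝒜 F)
    (hn : ∀ y, (F y).IsHomogeneous n) {M : Y → Matrix (Fin 3) (Fin 3) ℂ}
    (hM : ∀ i j, (fun y => M y i j) ∈ 𝒜) : CoeffsIn 𝒜 fun y => PlaneFoliation.comp (M y) (F y) := by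
  have : (fun y => PlaneFoliation.comp (M y) (F y)) = fun y =>
      ∑ m ∈ Finset.univ.finsuppAntidiag n, MvPolynomial.C (coeff m (F y)) *
        ∏ i, (∑ j, MvPolynomial.C (M y i j) * X j) ^ m i := by
    ext1 y
    conv_lhs => rw [eq_sum_of_isHomogeneous (hn y)]
    simp only [map_sum, map_smul]
    refine Finset.sum_congr rfl fun m _ => ?_
    rw [← smul_eq_C_mul, PlaneFoliation.comp, aeval_monomial, map_one, one_mul, Finsupp.prod_fintype _ _ (by simp)]
  rw [this]
  exact .sum _ fun m _ => .mul (.C (hF m)) (.prod _ fun i _ => .pow (.sum _ fun j _ =>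
    .mul (.C (hM i j)) (.const _)) _)

variable {d : ℕ}

/-- The coefficients of the 1-forms `ω y` belong to the algebra `𝒜` of functions of `y`. -/
def FormCoeffsIn (𝒜 : Subalgebra ℂ (Y → ℂ)) (ω : Y → Form d) : Prop :=
  ∀ i, CoeffsIn 𝒜 fun y => (ω y).1 i

theorem FormCoeffsIn.pullback {ω : Y → Form d} (hω : FormCoeffsIn 𝒜 ω)
    {M : Y → Matrix (Fin 3) (Fin 3) ℂ} (hM : ∀ i j, (fun y => M y i j) ∈ 𝒜) :
    FormCoeffsIn 𝒜 fun y => PlaneFoliation.pullback (M y) (ω y) := fun j =>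
  .sum _ fun i _ => .mul (.C (hM i j)) ((hω i).comp (fun y => (ω y).2.1 i) hM)

/-- The topology is defined by arbitrary linear forms on `Form d`; extending one to all triples of
polynomials reduces it to coefficients. -/
theorem FormCoeffsIn.dual_mem {ω : Y → Form d} (hω : FormCoeffsIn 𝒜 ω)
    (φ : Module.Dual ℂ (Form d)) : (fun y => φ (ω y)) ∈ 𝒜 := by
  obtain ⟨Φ, hΦ⟩ := LinearMap.exists_extend φ
  have : (fun y => φ (ω y)) =
      fun y => ∑ i, (Φ ∘ₗ LinearMap.single ℂ (fun _ => Poly3) i) ((ω y).1 i) := by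
    ext y
    rw [← hΦ, LinearMap.comp_apply, Submodule.subtype_apply]
    conv_lhs => rw [← Finset.univ_sum_single (ω y).1]
    rw [map_sum]
    rfl
  rw [this]
  exact fun_sum_mem _ fun i _ => (hω i).linear_mem (fun y => (ω y).2.1 i) _

end Families

/-! ### Calculus of linear changes of coordinates -/

theorem eval_comp (M : Matrix (Fin 3) (Fin 3) ℂ) (f : Poly3) (v : Fin 3 → ℂ) :
    eval v (comp M f) = eval (M.mulVec v) f := by
  induction f using MvPolynomial.induction_on with
  | C a => simp
  | add p q hp hq => simp [hp, hq]
  | mul_X p i hp => simp [hp, comp_X, Matrix.mulVec, dotProduct]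

theorem pderiv_comp (M : Matrix (Fin 3) (Fin 3) ℂ) (f : Poly3) (j : Fin 3) :
    pderiv j (comp M f) = ∑ i, C (M i j) * comp M (pderiv i f) := by
  induction f using MvPolynomial.induction_on with
  | C a => simp
  | add p q hp hq => simp [hp, hq, mul_add, Finset.sum_add_distrib]
  | mul_X p k hp =>
    have h1 : pderiv j (comp M (X k)) = C (M k j) := by
      simp [comp_X, pderiv_X, Pi.single_apply, Derivation.leibniz]
    have h2 : ∀ i, comp M (pderiv i (p * X k)) =
        comp M p * (if k = i then 1 else 0) + comp M (X k) * comp M (pderiv i p) := fun i => by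
      rw [Derivation.leibniz, pderiv_X, Pi.single_apply, smul_eq_mul, smul_eq_mul, map_add,
        map_mul, map_mul]
      split_ifs <;> simp
    simp only [h2, mul_add, Finset.sum_add_distrib]
    rw [map_mul, Derivation.leibniz, h1, hp, smul_eq_mul, smul_eq_mul, Finset.mul_sum]
    refine congrArg₂ (· + ·) ?_ ?_
    · simp [mul_comm]
    · exact Finset.sum_congr rfl fun i _ => by ring

theorem comp_scalar {f : Poly3} {n : ℕ} (hf : f.IsHomogeneous n) (μ : ℂ) :
    comp (μ • (1 : Matrix (Fin 3) (Fin 3) ℂ)) f = C (μ ^ n) * f := by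
  apply MvPolynomial.funext
  intro v
  have h : (μ • (1 : Matrix (Fin 3) (Fin 3) ℂ)).mulVec v = μ • v := by
    rw [Matrix.smul_mulVec, Matrix.one_mulVec]
  rw [eval_comp, h, eval_smul_of_isHomogeneous hf, map_mul, eval_C]

/-- Composition with an invertible matrix, as an automorphism of the polynomial ring. -/
def compEquiv (M : Matrix (Fin 3) (Fin 3) ℂ) (hM : IsUnit M.det) : Poly3 ≃ₐ[ℂ] Poly3 :=
  AlgEquiv.ofAlgHom (comp M) (comp M⁻¹)
    (AlgHom.ext fun f => by simp [comp_comp, Matrix.nonsing_inv_mul _ hM, comp_one])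
    (AlgHom.ext fun f => by simp [comp_comp, Matrix.mul_nonsing_inv _ hM, comp_one])

@[simp]
theorem compEquiv_apply (M : Matrix (Fin 3) (Fin 3) ℂ) (hM : IsUnit M.det) (f : Poly3) :
    compEquiv M hM f = comp M f := rfl

section Forms

variable {d : ℕ}

theorem pullback_apply (M : Matrix (Fin 3) (Fin 3) ℂ) (ω : Form d) (j : Fin 3) :
    (pullback M ω).1 j = ∑ i, C (M i j) * comp M (ω.1 i) := rfl

theorem smul_form_apply (c : ℂ) (ω : Form d) (j : Fin 3) : (c • ω).1 j = C c * ω.1 j := by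
  rw [← smul_eq_C_mul]; rfl

theorem pullback_smul (M : Matrix (Fin 3) (Fin 3) ℂ) (c : ℂ) (ω : Form d) :
    pullback M (c • ω) = c • pullback M ω := by
  apply Subtype.ext
  funext j
  simp only [pullback_apply, smul_form_apply, map_mul, comp_C, Finset.mul_sum]
  exact Finset.sum_congr rfl fun i _ => by ring

theorem pullback_scalar (μ : ℂ) (ω : Form d) :
    pullback (μ • (1 : Matrix (Fin 3) (Fin 3) ℂ)) ω = μ ^ (d + 2) • ω := by
  apply Subtype.ext
  funext j
  simp only [pullback_apply, smul_form_apply]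
  rw [Finset.sum_eq_single j]
  · rw [comp_scalar (ω.2.1 j)]
    simp only [Matrix.smul_apply, Matrix.one_apply_eq, smul_eq_mul, mul_one, ← mul_assoc, ← C_mul]
    rw [pow_succ' μ (d + 1)]
  · intro i _ hi
    simp [Matrix.one_apply_ne hi]
  · simp

/-- A form is determined by its first two coefficients. -/
theorem form_ext {ω η : Form d} (h0 : ω.1 0 = η.1 0) (h1 : ω.1 1 = η.1 1) : ω = η := by
  have hω := ω.2.2
  have hη := η.2.2
  rw [Fin.sum_univ_three] at hω hη
  have h2 : (X 2 : Poly3) * (ω.1 2 - η.1 2) = 0 := by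
    rw [h0, h1] at hω
    linear_combination hω - hη
  have h2 : ω.1 2 = η.1 2 := by
    rcases mul_eq_zero.mp h2 with h | h
    · exact absurd h (X_ne_zero 2)
    · exact sub_eq_zero.mp h
  apply Subtype.ext
  funext j
  fin_cases j
  · exact h0
  · exact h1
  · exact h2

/-- Differentiate the contraction identity xA + yB + zC = 0. -/
theorem form_add_sum_X_mul_pderiv (ω : Form d) (k : Fin 3) :
    ω.1 k + ∑ i, X i * pderiv k (ω.1 i) = 0 := by
  have h := congrArg (pderiv k) ω.2.2
  simp only [map_sum, Derivation.leibniz, smul_eq_mul, pderiv_X, Finset.sum_add_distrib, map_zero,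
    Pi.single_apply] at h
  rw [← h, add_comm]
  congr 1
  simp

theorem form_euler (ω : Form d) (k : Fin 3) :
    ∑ i, X i * pderiv i (ω.1 k) = C ((d : ℂ) + 1) * ω.1 k := by
  rw [(ω.2.1 k).sum_X_mul_pderiv]
  simp

end Forms

/-! ### Binary forms and the normal forms -/

/-- The binary form with coefficients `a`. -/
def binaryForm (d : ℕ) (a : ℕ → ℂ) : MvPolynomial (Fin 2) ℂ :=
  ∑ i ∈ Finset.range (d + 1), C (a i) * X 0 ^ i * X 1 ^ (d - i)

theorem binaryForm_isHomogeneous (d : ℕ) (a : ℕ → ℂ) : (binaryForm d a).IsHomogeneous d := by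
  refine IsHomogeneous.sum _ _ _ fun i hi => ?_
  have : d = 0 + i + (d - i) := by
    have := Finset.mem_range.mp hi
    omega
  conv => arg 2; rw [this]
  exact ((isHomogeneous_C _ _).mul (isHomogeneous_X_pow 0 i)).mul (isHomogeneous_X_pow 1 _)

theorem coeff_binaryForm (d : ℕ) (a : ℕ → ℂ) (m : Fin 2 →₀ ℕ) :
    coeff m (binaryForm d a) = if m 0 + m 1 = d then a (m 0) else 0 := by
  have h : ∀ i, (C (a i) * X 0 ^ i * X 1 ^ (d - i) : MvPolynomial (Fin 2) ℂ) =
      monomial (Finsupp.single 0 i + Finsupp.single 1 (d - i)) (a i) := fun i => by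
    rw [X_pow_eq_monomial, X_pow_eq_monomial, C_mul_monomial, monomial_mul]
    simp
  have hm : ∀ i, (Finsupp.single 0 i + Finsupp.single 1 (d - i) : Fin 2 →₀ ℕ) = m ↔
      i = m 0 ∧ d - i = m 1 := fun i => by
    rw [Finsupp.ext_iff, Fin.forall_fin_two]
    simp
  simp only [binaryForm, h, coeff_sum, coeff_monomial, hm]
  split_ifs with hd
  · rw [Finset.sum_eq_single (m 0)]
    · rw [if_pos ⟨rfl, by omega⟩]
    · intro i _ hi
      rw [if_neg fun h => hi h.1]
    · intro hi
      exact absurd (Finset.mem_range.mpr (by omega)) hi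
  · refine Finset.sum_eq_zero fun i hi => if_neg fun h => hd ?_
    have := Finset.mem_range.mp hi
    omega

theorem eq_binaryForm {d : ℕ} {P : MvPolynomial (Fin 2) ℂ} (hP : P.IsHomogeneous d) :
    P = binaryForm d (coeffYZ d P) := by
  ext m
  rw [coeff_binaryForm]
  split_ifs with hd
  · have : (Finsupp.single 0 (m 0) + Finsupp.single 1 (d - m 0) : Fin 2 →₀ ℕ) = m := by
      rw [Finsupp.ext_iff, Fin.forall_fin_two]
      simp
      omega
    rw [coeffYZ, this]
  · by_contra h
    have : m.degree = d := by
      rw [Finsupp.degree_eq_weight_one]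
      exact hP h
    rw [Finsupp.degree_eq_sum, Fin.sum_univ_two] at this
    exact hd this

theorem inYZ_binaryForm (d : ℕ) (a : ℕ → ℂ) :
    inYZ (binaryForm d a) =
      ∑ i ∈ Finset.range (d + 1), C (a i) * X 1 ^ i * X 2 ^ (d - i) := by
  simp [inYZ, binaryForm]

theorem atZZero_binaryForm (d : ℕ) (a : ℕ → ℂ) :
    atZZero (binaryForm d a) = Polynomial.C (a d) * Polynomial.X ^ d := by
  simp only [atZZero, binaryForm, map_sum, map_mul, map_pow, aeval_X, Matrix.cons_val_zero,
    Matrix.cons_val_one]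
  rw [Finset.sum_eq_single d]
  · simp [algHom_C]
  · intro i hi hid
    have := Finset.mem_range.mp hi
    simp [zero_pow (show d - i ≠ 0 by omega)]
  · simp

theorem atZZero_ne_zero_iff {d : ℕ} {P : MvPolynomial (Fin 2) ℂ} (hP : P.IsHomogeneous d) :
    atZZero P ≠ 0 ↔ coeffYZ d P d ≠ 0 := by
  conv_lhs => rw [eq_binaryForm hP, atZZero_binaryForm]
  simp

section Normal

variable {d : ℕ} (P : MvPolynomial (Fin 2) ℂ) (hP : P.IsHomogeneous d)

/-- The 1-form of the vector field `P(y,z) ∂/∂x + z^d ∂/∂y`. -/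
abbrev normalForm : Form d := toForm (normalField P hP)

theorem normalForm_zero : (normalForm P hP).1 0 = -X 2 ^ (d + 1) := by
  simp [toForm, normalField, pow_succ']

theorem normalForm_one : (normalForm P hP).1 1 = X 2 * inYZ P := by
  simp [toForm, normalField]

theorem normalForm_two : (normalForm P hP).1 2 = X 0 * X 2 ^ d - X 1 * inYZ P := by
  simp [toForm, normalField]

theorem pencilG_isHomogeneous : (pencilG d P).IsHomogeneous (d + 1) := by
  refine (IsHomogeneous.sum _ _ _ fun i hi => ?_).sub ?_
  · have : d + 1 = 0 + (i + 1) + (d - i) := by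
      have := Finset.mem_range.mp hi
      omega
    conv => arg 2; rw [this]
    exact ((isHomogeneous_C _ _).mul (isHomogeneous_X_pow 1 _)).mul (isHomogeneous_X_pow 2 _)
  · rw [add_comm]
    exact (isHomogeneous_X ℂ 0).mul (isHomogeneous_X_pow 2 d)

theorem pderiv_zero_pencilG : pderiv 0 (pencilG d P) = -X 2 ^ d := by
  simp [pencilG, Derivation.leibniz, pderiv_X, Derivation.leibniz_pow]

include hP in
-- The denominators i + 1 make the sum in G an antiderivative of P in y.
theorem pderiv_one_pencilG : pderiv 1 (pencilG d P) = inYZ P := by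
  conv_rhs => rw [eq_binaryForm hP, inYZ_binaryForm]
  simp only [pencilG, map_sub, map_sum, Derivation.leibniz, Derivation.leibniz_pow, pderiv_X]
  simp
  refine Finset.sum_congr rfl fun i _ => ?_
  have : (i : ℂ) + 1 ≠ 0 := by exact_mod_cast Nat.succ_ne_zero i
  have h : (C (coeffYZ d P i / ((i : ℂ) + 1)) : Poly3) * ((i : Poly3) + 1) =
      C (coeffYZ d P i) := by
    rw [show ((i : Poly3) + 1) = C ((i : ℂ) + 1) by simp, ← C_mul, div_mul_cancel₀ _ this]
  rw [← h]
  ring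

/-- The form of the normal foliation is `z dG - (d + 1) G dz`. -/
theorem normalForm_eq (j : Fin 3) : (normalForm P hP).1 j =
    X 2 * pderiv j (pencilG d P) - C ((d : ℂ) + 1) * pencilG d P * (if j = 2 then 1 else 0) := by
  -- Euler's identity is needed for the dz-coefficient: z G_z − (d+1) G = −x G_x − y G_y.
  have hE := (pencilG_isHomogeneous (d := d) P).sum_X_mul_pderiv
  rw [Fin.sum_univ_three, pderiv_zero_pencilG, pderiv_one_pencilG P hP] at hE
  match j with
  | 0 =>
    rw [normalForm_zero, pderiv_zero_pencilG, if_neg (by decide), pow_succ']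
    ring
  | 1 =>
    rw [normalForm_one, pderiv_one_pencilG P hP, if_neg (by decide)]
    ring
  | 2 =>
    have h3 : (C ((d : ℂ) + 1) : Poly3) * pencilG d P = (d + 1) • pencilG d P := by
      simp [nsmul_eq_mul]
    rw [normalForm_two, if_pos rfl, mul_one, h3, ← hE]
    ring

/-- The pull-back of the normal form is `l dG - (d + 1) G dl`. -/
theorem pullback_normalForm_eq (M : Matrix (Fin 3) (Fin 3) ℂ) (j : Fin 3) :
    (pullback M (normalForm P hP)).1 j =
      comp M (X 2) * pderiv j (comp M (pencilG d P)) -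
        C ((d : ℂ) + 1) * comp M (pencilG d P) * C (M 2 j) := by
  simp only [pullback_apply, normalForm_eq, pderiv_comp, map_sub, map_mul, comp_C, mul_sub,
    Finset.sum_sub_distrib, Finset.mul_sum]
  refine congrArg₂ (· - ·) ?_ ?_
  · exact Finset.sum_congr rfl fun i _ => by ring
  · rw [Finset.sum_eq_single 2]
    · simp
      ring
    · intro i _ hi
      simp [hi]
    · simp

end Normal

/-! ### Members of the family -/

section Members

variable {d : ℕ}

theorem det_coe_ne_zero (g : SL(3, ℂ)) : (g.1).det ≠ 0 := by
  rw [g.2]; exact one_ne_zero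

theorem exists_form_smul_normalFoliation (P : MvPolynomial (Fin 2) ℂ) (hP : P.IsHomogeneous d)
    (g : SL(3, ℂ)) : ∃ c : ℂ, c ≠ 0 ∧
      (g • normalFoliation P hP).form = c • pullback (g⁻¹).1 (normalForm P hP) := by
  have hv : g • normalForm P hP ≠ 0 := (smul_ne_zero_iff_ne g).2 (normalField_toForm_ne_zero P hP)
  obtain ⟨c, hc⟩ := Projectivization.exists_smul_eq_mk_rep ℂ (g • normalForm P hP) hv
  exact ⟨c, c.ne_zero, hc.symm⟩

theorem exists_form_of_mem_orbitFamily {F : FoliationSpace d} (hF : F ∈ orbitFamily d) :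
    ∃ (P : MvPolynomial (Fin 2) ℂ) (hP : P.IsHomogeneous d) (g : SL(3, ℂ)) (c : ℂ),
      atZZero P ≠ 0 ∧ c ≠ 0 ∧ F.form = c • pullback g.1 (normalForm P hP) := by
  obtain ⟨P, hP, ha, g, rfl⟩ := hF
  obtain ⟨c, hc, h⟩ := exists_form_smul_normalFoliation P hP g
  exact ⟨P, hP, g⁻¹, c, ha, hc, h⟩

/-- Dividing M by a cube root μ of its determinant gives an element of SL(3); the scalar matrix μ
acts on forms as multiplication by μ^(d+2), which is invisible projectively. -/
theorem mk_mem_orbitFamily {P : MvPolynomial (Fin 2) ℂ} (hP : P.IsHomogeneous d)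
    (ha : atZZero P ≠ 0) {M : Matrix (Fin 3) (Fin 3) ℂ} (hM : M.det ≠ 0) {c : ℂ}
    {v : Form d} (hv : v ≠ 0) (h : v = c • pullback M (normalForm P hP)) :
    (Projectivization.mk ℂ v hv : FoliationSpace d) ∈ orbitFamily d := by
  obtain ⟨μ, hμ⟩ := IsAlgClosed.exists_pow_nat_eq M.det (n := 3) (by norm_num)
  have hμ0 : μ ≠ 0 := by
    rintro rfl
    exact hM (by rw [← hμ]; simp)
  let g : SL(3, ℂ) := ⟨μ⁻¹ • M, by
    rw [Matrix.det_smul, Fintype.card_fin, ← hμ, inv_pow, inv_mul_cancel₀ (pow_ne_zero _ hμ0)]⟩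
  have hMg : M = g.1 * (μ • 1) := by
    simp [g, smul_smul, mul_inv_cancel₀ hμ0]
  refine ⟨P, hP, ha, g⁻¹, ?_⟩
  have hv' : g⁻¹ • normalForm P hP ≠ 0 :=
    (smul_ne_zero_iff_ne _).2 (normalField_toForm_ne_zero P hP)
  change Projectivization.mk ℂ (g⁻¹ • normalForm P hP) hv' = Projectivization.mk ℂ v hv
  symm
  rw [Projectivization.mk_eq_mk_iff']
  refine ⟨c * μ ^ (d + 2), ?_⟩
  change _ • pullback (g⁻¹⁻¹).1 (normalForm P hP) = v
  rw [inv_inv, h, hMg, ← pullback_pullback, pullback_scalar, smul_smul]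

theorem smul_mem_orbitFamily (g : SL(3, ℂ)) {F : FoliationSpace d} (hF : F ∈ orbitFamily d) :
    g • F ∈ orbitFamily d := by
  obtain ⟨P, hP, ha, h⟩ := hF
  exact ⟨P, hP, ha, (MulAction.smul_orbit_subset g _) ⟨F, h, rfl⟩⟩

theorem continuous_smul_foliationSpace (g : SL(3, ℂ)) :
    Continuous fun F : FoliationSpace d => g • F := by
  refine continuous_of_rep_eq_smul (DistribSMul.toLinearMap ℂ (Form d) g)
    (fun F : ℙ ℂ (Form d) => (g • (F : FoliationSpace d) : FoliationSpace d)) fun x => ?_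
  have hv : g • x.rep ≠ 0 := (smul_ne_zero_iff_ne g).2 x.rep_nonzero
  obtain ⟨c, hc⟩ := Projectivization.exists_smul_eq_mk_rep ℂ (g • x.rep) hv
  refine ⟨c, c.ne_zero, ?_⟩
  have hx : (g • (x : FoliationSpace d) : FoliationSpace d) =
      Projectivization.mk ℂ (g • x.rep) hv := by
    conv_lhs => rw [← Projectivization.mk_rep x]
    rfl
  rw [hx]
  exact hc.symm

theorem isUnit_of_dvd_X_pow {σ : Type*} {i : σ} {q : MvPolynomial σ ℂ} {n : ℕ} (h : q ∣ X i ^ n)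
    (hi : ¬ X i ∣ q) : IsUnit q := by
  obtain ⟨k, -, hk⟩ := (dvd_prime_pow (X_prime (i := i)) n).1 h
  rcases Nat.eq_zero_or_pos k with rfl | hk0
  · exact hk.symm.isUnit (by simp)
  · exact absurd ((dvd_pow_self _ hk0.ne').trans hk.symm.dvd) hi

variable {P : MvPolynomial (Fin 2) ℂ}

theorem eval_inYZ_of_z_eq_zero (hP : P.IsHomogeneous d) {v : Fin 3 → ℂ} (hv : v 2 = 0) :
    eval v (inYZ P) = coeffYZ d P d * v 1 ^ d := by
  rw [eq_binaryForm hP, inYZ_binaryForm, ← eq_binaryForm hP, map_sum, Finset.sum_eq_single d]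
  · simp
  · intro i hi hid
    have := Finset.mem_range.mp hi
    simp [hv, zero_pow (show d - i ≠ 0 by omega)]
  · simp

theorem eval_pencilG_of_z_eq_zero (hd : 1 ≤ d) {v : Fin 3 → ℂ} (hv : v 2 = 0) :
    eval v (pencilG d P) = coeffYZ d P d / ((d : ℂ) + 1) * v 1 ^ (d + 1) := by
  rw [pencilG, map_sub, map_sum, Finset.sum_eq_single d]
  · simp [hv, show d ≠ 0 by omega]
  · intro i hi hid
    have := Finset.mem_range.mp hi
    simp [hv, zero_pow (show d - i ≠ 0 by omega)]
  · simp

theorem not_X_dvd_of_eval_ne_zero {f : Poly3} {v : Fin 3 → ℂ} (hv : v 2 = 0) (hf : eval v f ≠ 0) :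
    ¬ X 2 ∣ f := by
  rintro ⟨q, rfl⟩
  simp [hv] at hf

theorem zero_notMem_vars_inYZ (Q : MvPolynomial (Fin 2) ℂ) : (0 : Fin 3) ∉ (inYZ Q).vars := by
  classical
  intro h
  have := vars_rename _ _ h
  simp at this

theorem eval_pencilG_ne_zero (hd : 1 ≤ d) (ha : coeffYZ d P d ≠ 0) :
    eval ![0, 1, 0] (pencilG d P) ≠ 0 := by
  rw [eval_pencilG_of_z_eq_zero hd rfl]
  simp [ha, Nat.cast_add_one_ne_zero]

/-- The members of the pencil other than `z^(d+1)` are irreducible. -/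
theorem irreducible_pencil (hd : 1 ≤ d) (ha : coeffYZ d P d ≠ 0) {α : ℂ} (hα : α ≠ 0) (β : ℂ) :
    Irreducible (C α * pencilG d P - C β * X 2 ^ (d + 1)) := by
  -- The member is f x + Q with f = −α z^d and Q free of x. A common divisor of f and Q divides a
  -- power of z, and z does not divide Q because Q is nonzero at (0,1,0).
  obtain ⟨Q, hQ⟩ : ∃ Q, inYZ Q = C α * (pencilG d P + X 0 * X 2 ^ d) - C β * X 2 ^ (d + 1) :=
    ⟨C α * ∑ i ∈ Finset.range (d + 1), C (coeffYZ d P i / ((i : ℂ) + 1)) * X 0 ^ (i + 1) *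
      X 1 ^ (d - i) - C β * X 1 ^ (d + 1), by simp [inYZ, pencilG]⟩
  obtain ⟨f, hf⟩ : ∃ f, inYZ f = C (-α) * X 2 ^ d := ⟨C (-α) * X 1 ^ d, by simp [inYZ]⟩
  have heq : C α * pencilG d P - C β * X 2 ^ (d + 1) = inYZ f * X 0 + inYZ Q := by
    rw [hQ, hf, C_neg]
    ring
  have h0 : inYZ f ≠ 0 := by
    rw [hf]
    exact mul_ne_zero (C_ne_zero.2 (neg_ne_zero.2 hα)) (pow_ne_zero _ (X_ne_zero 2))
  have hrel : IsRelPrime (inYZ f) (inYZ Q) := by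
    intro q hq hq'
    have hu : IsUnit (C (-α) : Poly3) := (IsUnit.mk0 (-α) (neg_ne_zero.2 hα)).map C
    rw [hf, hu.dvd_mul_left] at hq
    refine isUnit_of_dvd_X_pow hq fun h => ?_
    refine not_X_dvd_of_eval_ne_zero (v := ![0, 1, 0]) rfl ?_ (h.trans hq')
    rw [hQ, map_sub, map_mul, map_mul, map_add, eval_C]
    simpa [hα, show d ≠ 0 by omega] using eval_pencilG_ne_zero hd ha
  rw [heq]
  exact irreducible_mul_X_add _ _ _ h0 (zero_notMem_vars_inYZ f) (zero_notMem_vars_inYZ Q) hrel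

theorem isRelPrime_pencil (hd : 1 ≤ d) (ha : coeffYZ d P d ≠ 0) :
    IsRelPrime (pencilG d P) (X 2 ^ (d + 1)) := by
  intro q hq hq'
  refine isUnit_of_dvd_X_pow hq' fun h => ?_
  exact not_X_dvd_of_eval_ne_zero rfl (eval_pencilG_ne_zero hd ha) (h.trans hq)

/-- The only possibly reducible member of the pencil is the one with α = 0, a multiple of z^(d+1).
-/
theorem setOf_rep_zero_eq_zero_subsingleton :
    {t : ℙ ℂ (Fin 2 → ℂ) | t.rep 0 = 0}.Subsingleton := by
  intro s hs t ht
  have h1 : ∀ u : ℙ ℂ (Fin 2 → ℂ), u.rep 0 = 0 → u.rep 1 ≠ 0 := fun u hu h => by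
    refine u.rep_nonzero (funext fun i => ?_)
    fin_cases i
    · exact hu
    · exact h
  rw [← s.mk_rep, ← t.mk_rep, Projectivization.mk_eq_mk_iff']
  refine ⟨s.rep 1 / t.rep 1, funext fun i => ?_⟩
  fin_cases i
  · simp [show s.rep 0 = 0 from hs, show t.rep 0 = 0 from ht]
  · simp [div_mul_cancel₀ _ (h1 t ht)]

section

variable (hP : P.IsHomogeneous d) {F : FoliationSpace d} {M : Matrix (Fin 3) (Fin 3) ℂ}
  (hM : IsUnit M.det) {c : ℂ} (hc : c ≠ 0)
  (hF : F.form = c • pullback M (normalForm P hP))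

include hM hc hF

theorem isRationalFirstIntegral_of_form_eq (hd : 1 ≤ d) (ha : coeffYZ d P d ≠ 0) :
    F.IsRationalFirstIntegral (d + 1) (comp M (pencilG d P)) (comp M (X 2 ^ (d + 1))) := by
  refine ⟨comp_isHomogeneous M (pencilG_isHomogeneous P),
    comp_isHomogeneous M (isHomogeneous_X_pow 2 _), ?_, ?_, ?_⟩
  · intro q hq hq'
    have h1 := map_dvd (compEquiv M hM).symm hq
    have h2 := map_dvd (compEquiv M hM).symm hq'
    rw [← compEquiv_apply M hM, AlgEquiv.symm_apply_apply] at h1 h2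
    simpa using isRelPrime_pencil hd ha h1 h2
  · refine setOf_rep_zero_eq_zero_subsingleton.finite.subset fun t ht => ?_
    by_contra h0
    refine ht ?_
    have := irreducible_pencil hd ha h0 (t.rep 1)
    rw [← MulEquiv.irreducible_iff (compEquiv M hM)] at this
    simpa [comp_C] using this
  -- With l the pullback of z and G that of the pencil generator, G d(l^(d+1)) − l^(d+1) dG = −l^d
  -- (l dG − (d+1) G dl), and the bracket is c⁻¹ times the form of `F`.
  · refine ⟨-C c⁻¹ * comp M (X 2) ^ d, ?_, fun i => ?_⟩
    · refine mul_ne_zero (by simpa using hc) (pow_ne_zero _ ?_)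
      rw [← compEquiv_apply M hM]
      exact (EmbeddingLike.map_ne_zero_iff).2 (X_ne_zero 2)
    · have hl : pderiv i (comp M (X 2)) = C (M 2 i) := by
        simp [comp_X, pderiv_X, Pi.single_apply, Derivation.leibniz]
      have hcc : (C c⁻¹ * C c : Poly3) = 1 := by
        rw [← C_mul, inv_mul_cancel₀ hc, C_1]
      rw [hF, smul_form_apply, pullback_normalForm_eq, map_pow, Derivation.leibniz_pow, hl]
      simp only [smul_eq_mul, nsmul_eq_mul, add_tsub_cancel_right, Nat.cast_add, Nat.cast_one,
        map_add, map_natCast, C_1]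
      linear_combination (comp M (X 2) ^ d * (comp M (X 2) * pderiv i (comp M (pencilG d P)) -
        (d + 1) * comp M (pencilG d P) * C (M 2 i))) * hcc

/-- Transported back by M⁻¹, a common factor divides z^(d+1), so it is a unit unless z divides it;
but the dz-coefficient is −a_d at (0,1,0). -/
theorem noCommonFactor_of_form_eq (ha : coeffYZ d P d ≠ 0) : F.NoCommonFactor := by
  intro h hh
  have hω : pullback M⁻¹ F.form = c • normalForm P hP := by
    rw [hF, pullback_smul, pullback_pullback, Matrix.mul_nonsing_inv _ hM, pullback_one]
  have hdvd : ∀ i, (compEquiv M hM).symm h ∣ (normalForm P hP).1 i := by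
    intro i
    have h1 : (compEquiv M hM).symm h ∣ (pullback M⁻¹ F.form).1 i := by
      rw [pullback_apply]
      exact Finset.dvd_sum fun j _ =>
        Dvd.dvd.mul_left (map_dvd (compEquiv M hM).symm (hh j)) (C (M⁻¹ j i))
    rw [hω, smul_form_apply] at h1
    exact (((IsUnit.mk0 c hc).map C).dvd_mul_left).1 h1
  have hu : IsUnit ((compEquiv M hM).symm h) := by
    have h0 := hdvd 0
    rw [normalForm_zero, dvd_neg] at h0
    refine isUnit_of_dvd_X_pow h0 fun h2 => ?_
    have h3 := h2.trans (hdvd 2)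
    refine not_X_dvd_of_eval_ne_zero (v := ![0, 1, 0]) rfl ?_ h3
    rw [normalForm_two, map_sub, map_mul, map_mul, eval_inYZ_of_z_eq_zero hP rfl]
    simpa using ha
  simpa using hu

theorem existsUnique_mem_singularSet_of_form_eq (hd : 1 ≤ d) (ha : coeffYZ d P d ≠ 0) :
    ∃! p, p ∈ F.singularSet := by
  have hsing : ∀ p : ℙ ℂ (Fin 3 → ℂ), p ∈ F.singularSet ↔
      M.mulVec p.rep 1 = 0 ∧ M.mulVec p.rep 2 = 0 := by
    intro p
    -- Up to c, the coefficients of the pullback at v are the row vector of the normal coefficients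
    -- at M v, multiplied by the invertible M. So v is singular exactly when M v is singular for the
    -- normal form.
    have h1 : p ∈ F.singularSet ↔
        Matrix.vecMul (fun i => eval (M.mulVec p.rep) ((normalForm P hP).1 i)) M = 0 := by
      rw [_root_.funext_iff]
      refine forall_congr' fun j => ?_
      rw [hF, smul_form_apply, map_mul, eval_C, mul_eq_zero, or_iff_right hc, pullback_apply,
        map_sum]
      simp only [map_mul, eval_C, eval_comp, Matrix.vecMul, dotProduct, mul_comm, Pi.zero_apply]
    have hinj : Function.Injective fun v => Matrix.vecMul v M :=
      Matrix.vecMul_injective_of_isUnit ((Matrix.isUnit_iff_isUnit_det M).2 hM)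
    rw [h1, ← Matrix.zero_vecMul M, hinj.eq_iff, _root_.funext_iff, Fin.forall_fin_succ,
      Fin.forall_fin_two]
    simp only [Fin.succ_zero_eq_one, Fin.succ_one_eq_two, normalForm_zero, normalForm_one,
      normalForm_two, Pi.zero_apply]
    constructor
    · rintro ⟨h0, -, h2⟩
      have hz : M.mulVec p.rep 2 = 0 := by simpa using h0
      rw [map_sub, map_mul, map_mul, eval_inYZ_of_z_eq_zero hP hz] at h2
      simp [hz, ha, show d ≠ 0 by omega] at h2
      exact ⟨h2, hz⟩
    · rintro ⟨hy, hz⟩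
      simp [hy, hz, show d ≠ 0 by omega]
  let e : Fin 3 → ℂ := ![1, 0, 0]
  have he : M⁻¹.mulVec e ≠ 0 := fun h => by
    have := congrArg M.mulVec h
    rw [Matrix.mulVec_mulVec, Matrix.mul_nonsing_inv _ hM, Matrix.one_mulVec,
      Matrix.mulVec_zero] at this
    exact one_ne_zero (congrFun this 0)
  refine ⟨Projectivization.mk ℂ _ he, ?_, fun p hp => ?_⟩
  · obtain ⟨k, hk⟩ := Projectivization.exists_smul_eq_mk_rep ℂ (M⁻¹.mulVec e) he
    rw [hsing, ← hk, Units.smul_def, Matrix.mulVec_smul, Matrix.mulVec_mulVec,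
      Matrix.mul_nonsing_inv _ hM, Matrix.one_mulVec]
    simp [e]
  · replace hp := (hsing p).1 hp
    rw [← p.mk_rep, Projectivization.mk_eq_mk_iff']
    refine ⟨M.mulVec p.rep 0, ?_⟩
    have : M.mulVec p.rep = M.mulVec p.rep 0 • e := by
      ext i
      fin_cases i
      · simp [e]
      · simpa [e] using hp.1
      · simpa [e] using hp.2
    rw [← Matrix.mulVec_smul, ← this, Matrix.mulVec_mulVec, Matrix.nonsing_inv_mul _ hM,
      Matrix.one_mulVec]

end

end Members

/-! ### Reduction of a form to normal form -/

section Reduction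

variable {d : ℕ}

/-- The change of coordinates `x ↦ x + t y`. -/
def shearXY (t : ℂ) : Matrix (Fin 3) (Fin 3) ℂ := !![1, t, 0; 0, 1, 0; 0, 0, 1]

/-- The change of coordinates `z ↦ z + t y`. -/
def shearZY (t : ℂ) : Matrix (Fin 3) (Fin 3) ℂ := !![1, 0, 0; 0, 1, 0; 0, t, 1]

/-- The change of coordinates `z ↦ z + t x`. -/
def shearZX (t : ℂ) : Matrix (Fin 3) (Fin 3) ℂ := !![1, 0, 0; 0, 1, 0; t, 0, 1]

/-- The change of coordinates `y ↦ y + t x`. -/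
def shearYX (t : ℂ) : Matrix (Fin 3) (Fin 3) ℂ := !![1, 0, 0; t, 1, 0; 0, 0, 1]

theorem shearXY_mul_neg (t : ℂ) : shearXY t * shearXY (-t) = 1 := by
  ext i j; fin_cases i <;> fin_cases j <;> simp [shearXY, Matrix.mul_apply, Fin.sum_univ_three]

theorem shearZY_mul_neg (t : ℂ) : shearZY t * shearZY (-t) = 1 := by
  ext i j; fin_cases i <;> fin_cases j <;> simp [shearZY, Matrix.mul_apply, Fin.sum_univ_three]

theorem shearZX_mul_neg (t : ℂ) : shearZX t * shearZX (-t) = 1 := by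
  ext i j; fin_cases i <;> fin_cases j <;> simp [shearZX, Matrix.mul_apply, Fin.sum_univ_three]

theorem shearYX_mul_neg (t : ℂ) : shearYX t * shearYX (-t) = 1 := by
  ext i j; fin_cases i <;> fin_cases j <;> simp [shearYX, Matrix.mul_apply, Fin.sum_univ_three]

/-- The coefficient of `dx` at `(0 : 0 : 1)`, as a linear function of the form. -/
def dxAtZ : Module.Dual ℂ (Form d) :=
  (aeval ![0, 0, 1] : Poly3 →ₐ[ℂ] ℂ).toLinearMap ∘ₗ LinearMap.proj 0 ∘ₗ (Form d).subtype

/-- The coefficient of `dy` at `(0 : 0 : 1)`. -/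
def dyAtZ (ω : Form d) : ℂ := eval ![0, 0, 1] (ω.1 1)

/-- The coefficient of `dx ∧ dy` in `dω` at `(0 : 0 : 1)`. -/
def curlAtZ (ω : Form d) : ℂ := eval ![0, 0, 1] (pderiv 0 (ω.1 1) - pderiv 1 (ω.1 0))

/-- The coefficient of `dx` at `(0 : 1 : 0)`. -/
def dxAtY (ω : Form d) : ℂ := eval ![0, 1, 0] (ω.1 0)

/-- The coefficient of `dz` at `(0 : 1 : 0)`. -/
def dzAtY (ω : Form d) : ℂ := eval ![0, 1, 0] (ω.1 2)

/-- The `z`-derivative of the coefficient of `dx` at `(0 : 1 : 0)`. -/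
def dxDerivAtY (ω : Form d) : ℂ := eval ![0, 1, 0] (pderiv 2 (ω.1 0))

theorem dxAtZ_apply (ω : Form d) : dxAtZ ω = eval ![0, 0, 1] (ω.1 0) := rfl

theorem mulVec_shear (t : ℂ) :
    (shearXY t).mulVec ![0, 0, 1] = ![0, 0, 1] ∧ (shearZY t).mulVec ![0, 0, 1] = ![0, 0, 1] ∧
    (shearZX t).mulVec ![0, 0, 1] = ![0, 0, 1] ∧ (shearYX t).mulVec ![0, 0, 1] = ![0, 0, 1] ∧
    (shearZX t).mulVec ![0, 1, 0] = ![0, 1, 0] ∧ (shearYX t).mulVec ![0, 1, 0] = ![0, 1, 0] := by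
  refine ⟨?_, ?_, ?_, ?_, ?_, ?_⟩ <;> ext i <;> fin_cases i <;>
    simp [shearXY, shearZY, shearZX, shearYX, Matrix.mulVec, dotProduct, Fin.sum_univ_three]

/-- The contraction identity, its x- and y-derivatives, and Euler's identity for A and B, all
evaluated at (0,0,1). -/
theorem form_relations_at_z (ω : Form d) :
    eval ![0, 0, 1] (ω.1 2) = 0 ∧
    eval ![0, 0, 1] (pderiv 0 (ω.1 2)) = -eval ![0, 0, 1] (ω.1 0) ∧
    eval ![0, 0, 1] (pderiv 1 (ω.1 2)) = -eval ![0, 0, 1] (ω.1 1) ∧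
    eval ![0, 0, 1] (pderiv 2 (ω.1 0)) = (d + 1) * eval ![0, 0, 1] (ω.1 0) ∧
    eval ![0, 0, 1] (pderiv 2 (ω.1 1)) = (d + 1) * eval ![0, 0, 1] (ω.1 1) := by
  have h1 := congrArg (eval ![0, 0, 1]) ω.2.2
  have h2 := congrArg (eval ![0, 0, 1]) (form_add_sum_X_mul_pderiv ω 0)
  have h3 := congrArg (eval ![0, 0, 1]) (form_add_sum_X_mul_pderiv ω 1)
  have h4 := congrArg (eval ![0, 0, 1]) (form_euler ω 0)
  have h5 := congrArg (eval ![0, 0, 1]) (form_euler ω 1)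
  simp only [Fin.sum_univ_three, map_add, map_mul, eval_X, eval_C, map_zero, Matrix.cons_val,
    zero_mul, zero_add, one_mul] at h1 h2 h3 h4 h5
  exact ⟨h1, by linear_combination h2, by linear_combination h3, h4, h5⟩

theorem form_relations_at_y (ω : Form d) :
    eval ![0, 1, 0] (ω.1 1) = 0 ∧
    eval ![0, 1, 0] (pderiv 2 (ω.1 1)) = -eval ![0, 1, 0] (ω.1 2) := by
  have h1 := congrArg (eval ![0, 1, 0]) ω.2.2
  have h2 := congrArg (eval ![0, 1, 0]) (form_add_sum_X_mul_pderiv ω 2)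
  simp only [Fin.sum_univ_three, map_add, map_mul, eval_X, map_zero, Matrix.cons_val,
    zero_mul, zero_add, one_mul, add_zero] at h1 h2
  exact ⟨h1, by linear_combination h2⟩

theorem dxAtZ_shearXY (t : ℂ) (ω : Form d) : dxAtZ (pullback (shearXY t) ω) = dxAtZ ω := by
  simp only [dxAtZ_apply, pullback_apply, Fin.sum_univ_three, map_add, map_mul, eval_C, eval_comp,
    mulVec_shear]
  simp [shearXY]

theorem dyAtZ_shearXY (t : ℂ) (ω : Form d) :
    dyAtZ (pullback (shearXY t) ω) = dyAtZ ω + t * dxAtZ ω := by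
  simp only [dyAtZ, dxAtZ_apply, pullback_apply, Fin.sum_univ_three, map_add, map_mul, eval_C,
    eval_comp, mulVec_shear]
  simp [shearXY]
  ring

theorem dxAtZ_shearZY (t : ℂ) (ω : Form d) : dxAtZ (pullback (shearZY t) ω) = dxAtZ ω := by
  simp only [dxAtZ_apply, pullback_apply, Fin.sum_univ_three, map_add, map_mul, eval_C, eval_comp,
    mulVec_shear]
  simp [shearZY]

theorem dyAtZ_shearZY (t : ℂ) (ω : Form d) : dyAtZ (pullback (shearZY t) ω) = dyAtZ ω := by
  simp only [dyAtZ, pullback_apply, Fin.sum_univ_three, map_add, map_mul, eval_C,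
    eval_comp, mulVec_shear, form_relations_at_z]
  simp [shearZY]

/-- The shear adds t (C_x − A_z), and at (0,0,1) one has C_x = −A and A_z = (d+1) A; hence the
factor d + 2. -/
theorem curlAtZ_shearZY (t : ℂ) (ω : Form d) :
    curlAtZ (pullback (shearZY t) ω) = curlAtZ ω - t * (d + 2) * dxAtZ ω := by
  simp only [curlAtZ, dxAtZ_apply, pullback_apply, Fin.sum_univ_three, map_add, map_sub,
    Derivation.leibniz, pderiv_C, pderiv_comp, smul_eq_mul, map_mul, eval_C, eval_comp,
    mulVec_shear, form_relations_at_z, mul_zero, add_zero]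
  simp [shearZY]
  ring

theorem dxAtZ_shearZX (t : ℂ) (ω : Form d) : dxAtZ (pullback (shearZX t) ω) = dxAtZ ω := by
  simp only [dxAtZ_apply, pullback_apply, Fin.sum_univ_three, map_add, map_mul, eval_C, eval_comp,
    mulVec_shear, form_relations_at_z]
  simp [shearZX]

theorem dyAtZ_shearZX (t : ℂ) (ω : Form d) : dyAtZ (pullback (shearZX t) ω) = dyAtZ ω := by
  simp only [dyAtZ, pullback_apply, Fin.sum_univ_three, map_add, map_mul, eval_C,
    eval_comp, mulVec_shear]
  simp [shearZX]

theorem curlAtZ_shearZX (t : ℂ) (ω : Form d) :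
    curlAtZ (pullback (shearZX t) ω) = curlAtZ ω + t * (d + 2) * dyAtZ ω := by
  simp only [curlAtZ, dyAtZ, pullback_apply, Fin.sum_univ_three, map_add, map_sub,
    Derivation.leibniz, pderiv_C, pderiv_comp, smul_eq_mul, map_mul, eval_C, eval_comp,
    mulVec_shear, form_relations_at_z, mul_zero, add_zero]
  simp [shearZX]
  ring

theorem dxAtY_shearZX (t : ℂ) (ω : Form d) :
    dxAtY (pullback (shearZX t) ω) = dxAtY ω + t * dzAtY ω := by
  simp only [dxAtY, dzAtY, pullback_apply, Fin.sum_univ_three, map_add, map_mul, eval_C,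
    eval_comp, mulVec_shear]
  simp [shearZX]

theorem dzAtY_shearZX (t : ℂ) (ω : Form d) : dzAtY (pullback (shearZX t) ω) = dzAtY ω := by
  simp only [dzAtY, pullback_apply, Fin.sum_univ_three, map_add, map_mul, eval_C,
    eval_comp, mulVec_shear]
  simp [shearZX]

theorem dxAtZ_shearYX (t : ℂ) (ω : Form d) :
    dxAtZ (pullback (shearYX t) ω) = dxAtZ ω + t * dyAtZ ω := by
  simp only [dxAtZ_apply, dyAtZ, pullback_apply, Fin.sum_univ_three, map_add, map_mul, eval_C,
    eval_comp, mulVec_shear]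
  simp [shearYX]

theorem dyAtZ_shearYX (t : ℂ) (ω : Form d) : dyAtZ (pullback (shearYX t) ω) = dyAtZ ω := by
  simp only [dyAtZ, pullback_apply, Fin.sum_univ_three, map_add, map_mul, eval_C,
    eval_comp, mulVec_shear]
  simp [shearYX]

theorem curlAtZ_shearYX (t : ℂ) (ω : Form d) :
    curlAtZ (pullback (shearYX t) ω) = curlAtZ ω := by
  simp only [curlAtZ, pullback_apply, Fin.sum_univ_three, map_add, map_sub,
    Derivation.leibniz, pderiv_C, pderiv_comp, smul_eq_mul, map_mul, eval_C, eval_comp,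
    mulVec_shear, mul_zero, add_zero]
  simp [shearYX]

theorem dxAtY_shearYX (t : ℂ) (ω : Form d) : dxAtY (pullback (shearYX t) ω) = dxAtY ω := by
  simp only [dxAtY, pullback_apply, Fin.sum_univ_three, map_add, map_mul, eval_C,
    eval_comp, mulVec_shear, form_relations_at_y]
  simp [shearYX]

theorem dzAtY_shearYX (t : ℂ) (ω : Form d) : dzAtY (pullback (shearYX t) ω) = dzAtY ω := by
  simp only [dzAtY, pullback_apply, Fin.sum_univ_three, map_add, map_mul, eval_C,
    eval_comp, mulVec_shear]
  simp [shearYX]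

theorem dxDerivAtY_shearYX (t : ℂ) (ω : Form d) :
    dxDerivAtY (pullback (shearYX t) ω) = dxDerivAtY ω - t * dzAtY ω := by
  simp only [dxDerivAtY, dzAtY, pullback_apply, Fin.sum_univ_three, map_add,
    Derivation.leibniz, pderiv_C, pderiv_comp, smul_eq_mul, map_mul, eval_C, eval_comp,
    mulVec_shear, form_relations_at_y, mul_zero, add_zero]
  simp [shearYX]
  ring

/-- The first parameter of the reduction. -/
def paramXY (ω : Form d) : ℂ := dyAtZ ω

/-- The second parameter of the reduction. -/
def paramZY (ω : Form d) : ℂ := -curlAtZ ω / (d + 2)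

/-- The third parameter of the reduction. -/
def paramZX (ω : Form d) : ℂ := -dxAtY ω / dzAtY ω

/-- The fourth parameter of the reduction. -/
def paramYX (ω : Form d) : ℂ := dxDerivAtY ω / dzAtY ω

/-- The form `ω` with the coefficient of `dy` at `(0 : 0 : 1)` removed. -/
def reduceXY (ω : Form d) : Form d := pullback (shearXY (paramXY ω)) ω

/-- The form `ω` with the coefficient of `dx ∧ dy` in `dω` at `(0 : 0 : 1)` removed. -/
def reduceZY (ω : Form d) : Form d := pullback (shearZY (paramZY ω)) ω

/-- The form `ω` with the coefficient of `dx` at `(0 : 1 : 0)` removed. -/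
def reduceZX (ω : Form d) : Form d := pullback (shearZX (paramZX ω)) ω

/-- The form `ω` with the `z`-derivative of the coefficient of `dx` at `(0 : 1 : 0)` removed. -/
def reduceYX (ω : Form d) : Form d := pullback (shearYX (paramYX ω)) ω

/-- The full reduction of a form. -/
def reduce (ω : Form d) : Form d := reduceYX (reduceZX (reduceZY (reduceXY ω)))

/-- The conditions that characterize reduced forms. -/
structure IsReduced (ω : Form d) : Prop where
  dxAtZ_eq : dxAtZ ω = -1
  dyAtZ_eq : dyAtZ ω = 0
  curlAtZ_eq : curlAtZ ω = 0
  dxAtY_eq : dxAtY ω = 0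
  dxDerivAtY_eq : dxDerivAtY ω = 0
  dzAtY_ne : dzAtY ω ≠ 0

theorem natCast_add_two_ne_zero (d : ℕ) : (d : ℂ) + 2 ≠ 0 := by
  exact_mod_cast (Nat.succ_ne_zero (d + 1))

/-- The order of the shears matters. The third changes the curl, and the fourth the dx-coefficient
at (0:0:1), by a multiple of the dy-coefficient there, which the first shear has already made zero;
the other quantities already normalized are left unchanged. -/
theorem isReduced_reduce {ω : Form d} (h : dxAtZ ω = -1)
    (h' : dzAtY (reduceZY (reduceXY ω)) ≠ 0) : IsReduced (reduce ω) := by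
  have hA1 : dxAtZ (reduceXY ω) = -1 := by rw [reduceXY, dxAtZ_shearXY, h]
  have hB1 : dyAtZ (reduceXY ω) = 0 := by
    rw [reduceXY, dyAtZ_shearXY, h, paramXY]; ring
  rw [reduce]
  generalize reduceXY ω = η at h' hA1 hB1 ⊢
  have hA2 : dxAtZ (reduceZY η) = -1 := by rw [reduceZY, dxAtZ_shearZY, hA1]
  have hB2 : dyAtZ (reduceZY η) = 0 := by rw [reduceZY, dyAtZ_shearZY, hB1]
  have hZ2 : curlAtZ (reduceZY η) = 0 := by
    rw [reduceZY, curlAtZ_shearZY, hA1, paramZY, div_mul_cancel₀ _ (natCast_add_two_ne_zero d)]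
    ring
  generalize reduceZY η = η at h' hA2 hB2 hZ2 ⊢
  have hA3 : dxAtZ (reduceZX η) = -1 := by rw [reduceZX, dxAtZ_shearZX, hA2]
  have hB3 : dyAtZ (reduceZX η) = 0 := by rw [reduceZX, dyAtZ_shearZX, hB2]
  have hZ3 : curlAtZ (reduceZX η) = 0 := by rw [reduceZX, curlAtZ_shearZX, hB2, hZ2]; ring
  have hC3 : dzAtY (reduceZX η) ≠ 0 := by rwa [reduceZX, dzAtY_shearZX]
  have hD3 : dxAtY (reduceZX η) = 0 := by
    rw [reduceZX, dxAtY_shearZX, paramZX, div_mul_cancel₀ _ h']; ring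
  generalize reduceZX η = η at hA3 hB3 hZ3 hC3 hD3 ⊢
  refine ⟨?_, ?_, ?_, ?_, ?_, ?_⟩
  · rw [reduceYX, dxAtZ_shearYX, hA3, hB3]; ring
  · rw [reduceYX, dyAtZ_shearYX, hB3]
  · rw [reduceYX, curlAtZ_shearYX, hZ3]
  · rw [reduceYX, dxAtY_shearYX, hD3]
  · rw [reduceYX, dxDerivAtY_shearYX, paramYX, div_mul_cancel₀ _ hC3]; ring
  · rwa [reduceYX, dzAtY_shearYX]

/-- The form with the given reduction parameters and the given reduction. -/
def unreduce (t₁ t₂ t₃ t₄ : ℂ) (ω : Form d) : Form d :=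
  pullback (shearXY (-t₁)) (pullback (shearZY (-t₂)) (pullback (shearZX (-t₃))
    (pullback (shearYX (-t₄)) ω)))

theorem pullback_cancel {M : ℂ → Matrix (Fin 3) (Fin 3) ℂ} (hM : ∀ t, M t * M (-t) = 1) (t : ℂ)
    (ω : Form d) : pullback (M (-t)) (pullback (M t) ω) = ω := by
  rw [pullback_pullback, hM, pullback_one]

theorem unreduce_reduce (ω : Form d) :
    unreduce (paramXY ω) (paramZY (reduceXY ω)) (paramZX (reduceZY (reduceXY ω)))
      (paramYX (reduceZX (reduceZY (reduceXY ω)))) (reduce ω) = ω := by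
  rw [unreduce, reduce, reduceYX, pullback_cancel shearYX_mul_neg]
  rw [reduceZX, pullback_cancel shearZX_mul_neg]
  rw [reduceZY, pullback_cancel shearZY_mul_neg]
  rw [reduceXY, pullback_cancel shearXY_mul_neg]

/-- The shears are undone one at a time. On a form satisfying the conditions reached at that stage,
applying the inverse shear moves the normalized quantity by an amount from which the parameter is
read back exactly. -/
theorem reduce_unreduce {ω : Form d} (h : IsReduced ω) (t₁ t₂ t₃ t₄ : ℂ) :
    let η := unreduce t₁ t₂ t₃ t₄ ω
    dxAtZ η = -1 ∧ dzAtY (reduceZY (reduceXY η)) = dzAtY ω ∧ paramXY η = t₁ ∧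
      paramZY (reduceXY η) = t₂ ∧ paramZX (reduceZY (reduceXY η)) = t₃ ∧
      paramYX (reduceZX (reduceZY (reduceXY η))) = t₄ ∧ reduce η = ω := by
  obtain ⟨hA, hB, hZ, hD, hE, hC⟩ := h
  have inv : ∀ {M : ℂ → Matrix (Fin 3) (Fin 3) ℂ}, (∀ t, M t * M (-t) = 1) →
      ∀ (t : ℂ) (η : Form d), pullback (M t) (pullback (M (-t)) η) = η := fun {M} hM t η => by
    simpa using pullback_cancel hM (-t) η
  rw [unreduce]
  have e4 : paramYX (pullback (shearYX (-t₄)) ω) = t₄ := by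
    rw [paramYX, dxDerivAtY_shearYX, dzAtY_shearYX, hE]
    field_simp
    ring
  have f4 : reduceYX (pullback (shearYX (-t₄)) ω) = ω := by
    rw [reduceYX, e4, inv shearYX_mul_neg]
  have hA3 : dxAtZ (pullback (shearYX (-t₄)) ω) = -1 := by rw [dxAtZ_shearYX, hA, hB]; ring
  have hB3 : dyAtZ (pullback (shearYX (-t₄)) ω) = 0 := by rw [dyAtZ_shearYX, hB]
  have hZ3 : curlAtZ (pullback (shearYX (-t₄)) ω) = 0 := by rw [curlAtZ_shearYX, hZ]
  have hD3 : dxAtY (pullback (shearYX (-t₄)) ω) = 0 := by rw [dxAtY_shearYX, hD]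
  have hC3 : dzAtY (pullback (shearYX (-t₄)) ω) = dzAtY ω := dzAtY_shearYX _ _
  generalize pullback (shearYX (-t₄)) ω = η₃ at *
  have e3 : paramZX (pullback (shearZX (-t₃)) η₃) = t₃ := by
    rw [paramZX, dxAtY_shearZX, dzAtY_shearZX, hD3, hC3]
    field_simp
    ring
  have f3 : reduceZX (pullback (shearZX (-t₃)) η₃) = η₃ := by
    rw [reduceZX, e3, inv shearZX_mul_neg]
  have hA2 : dxAtZ (pullback (shearZX (-t₃)) η₃) = -1 := by rw [dxAtZ_shearZX, hA3]
  have hB2 : dyAtZ (pullback (shearZX (-t₃)) η₃) = 0 := by rw [dyAtZ_shearZX, hB3]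
  have hZ2 : curlAtZ (pullback (shearZX (-t₃)) η₃) = 0 := by
    rw [curlAtZ_shearZX, hZ3, hB3]; ring
  have hC2 : dzAtY (pullback (shearZX (-t₃)) η₃) = dzAtY ω := by rw [dzAtY_shearZX, hC3]
  generalize pullback (shearZX (-t₃)) η₃ = η₂ at *
  have hd := natCast_add_two_ne_zero d
  have e2 : paramZY (pullback (shearZY (-t₂)) η₂) = t₂ := by
    rw [paramZY, curlAtZ_shearZY, hZ2, hA2]
    field_simp
    ring
  have f2 : reduceZY (pullback (shearZY (-t₂)) η₂) = η₂ := by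
    rw [reduceZY, e2, inv shearZY_mul_neg]
  have hA1 : dxAtZ (pullback (shearZY (-t₂)) η₂) = -1 := by rw [dxAtZ_shearZY, hA2]
  have hB1 : dyAtZ (pullback (shearZY (-t₂)) η₂) = 0 := by rw [dyAtZ_shearZY, hB2]
  generalize pullback (shearZY (-t₂)) η₂ = η₁ at *
  have e1 : paramXY (pullback (shearXY (-t₁)) η₁) = t₁ := by
    rw [paramXY, dyAtZ_shearXY, hA1, hB1]
    ring
  have f1 : reduceXY (pullback (shearXY (-t₁)) η₁) = η₁ := by
    rw [reduceXY, e1, inv shearXY_mul_neg]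
  have hA0 : dxAtZ (pullback (shearXY (-t₁)) η₁) = -1 := by rw [dxAtZ_shearXY, hA1]
  simp only [reduce, f1, f2, f3, f4, e1, e2, e3, e4, hA0, hC2, and_self]

end Reduction

/-! ### Reduced members of the family -/

section Reduced

variable {d : ℕ}

/-- The form of the normal foliation with the given coefficients. -/
def normalFormOf (d : ℕ) (a : ℕ → ℂ) : Form d :=
  normalForm (binaryForm d a) (binaryForm_isHomogeneous d a)

theorem coeffYZ_binaryForm (a : ℕ → ℂ) {i : ℕ} (hi : i ≤ d) :
    coeffYZ d (binaryForm d a) i = a i := by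
  rw [coeffYZ, coeff_binaryForm]
  simp [hi]

theorem normalFormOf_congr {a b : ℕ → ℂ} (h : ∀ i ≤ d, a i = b i) :
    normalFormOf d a = normalFormOf d b := by
  have : binaryForm d a = binaryForm d b :=
    Finset.sum_congr rfl fun i hi => by rw [h i (Nat.lt_succ_iff.1 (Finset.mem_range.1 hi))]
  simp only [normalFormOf, this]

theorem normalForm_eq_normalFormOf {P : MvPolynomial (Fin 2) ℂ} (hP : P.IsHomogeneous d) :
    normalForm P hP = normalFormOf d (coeffYZ d P) := by
  simp only [normalFormOf, ← eq_binaryForm hP]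

theorem eval_inYZ_at_z (a : ℕ → ℂ) : eval ![0, 0, 1] (inYZ (binaryForm d a)) = a 0 := by
  rw [inYZ_binaryForm, map_sum, Finset.sum_eq_single 0]
  · simp
  · intro i _ hi
    simp [hi]
  · simp

theorem pderiv_zero_inYZ (Q : MvPolynomial (Fin 2) ℂ) : pderiv 0 (inYZ Q) = 0 :=
  pderiv_eq_zero_of_notMem_vars (zero_notMem_vars_inYZ Q)

theorem dxAtZ_normalFormOf (a : ℕ → ℂ) : dxAtZ (normalFormOf d a) = -1 := by
  rw [dxAtZ_apply, normalFormOf, normalForm_zero]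
  simp

theorem dyAtZ_normalFormOf (a : ℕ → ℂ) : dyAtZ (normalFormOf d a) = a 0 := by
  rw [dyAtZ, normalFormOf, normalForm_one, map_mul, eval_inYZ_at_z]
  simp

theorem curlAtZ_normalFormOf (a : ℕ → ℂ) : curlAtZ (normalFormOf d a) = 0 := by
  rw [curlAtZ, normalFormOf, normalForm_zero, normalForm_one, Derivation.leibniz, pderiv_zero_inYZ]
  simp [Derivation.leibniz_pow, pderiv_X]

theorem dzAtY_normalFormOf (a : ℕ → ℂ) : dzAtY (normalFormOf d a) = -a d := by
  rw [dzAtY, normalFormOf, normalForm_two, map_sub, map_mul, map_mul,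
    eval_inYZ_of_z_eq_zero (binaryForm_isHomogeneous d a) rfl, coeffYZ_binaryForm a le_rfl]
  simp

theorem isReduced_normalFormOf (hd : 1 ≤ d) {a : ℕ → ℂ} (h0 : a 0 = 0) (ha : a d ≠ 0) :
    IsReduced (normalFormOf d a) := by
  refine ⟨dxAtZ_normalFormOf a, by rw [dyAtZ_normalFormOf, h0], curlAtZ_normalFormOf a, ?_, ?_, ?_⟩
  · rw [dxAtY, normalFormOf, normalForm_zero]
    simp
  · rw [dxDerivAtY, normalFormOf, normalForm_zero]
    simp [Derivation.leibniz_pow, show d ≠ 0 by omega]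
  · rw [dzAtY_normalFormOf]
    exact neg_ne_zero.2 ha

theorem pderiv_comm {σ : Type*} (i j : σ) (f : MvPolynomial σ ℂ) :
    pderiv i (pderiv j f) = pderiv j (pderiv i f) := by
  classical
  have : ⁅pderiv (R := ℂ) i, pderiv (R := ℂ) j⁆ = 0 := by
    apply derivation_ext
    intro k
    rw [Derivation.commutator_apply, pderiv_X, pderiv_X, Pi.single_apply, Pi.single_apply]
    split_ifs <;> simp
  have h := DFunLike.congr_fun this f
  rw [Derivation.commutator_apply] at h
  exact sub_eq_zero.1 h

theorem eval_comp_X (M : Matrix (Fin 3) (Fin 3) ℂ) (v : Fin 3 → ℂ) (i : Fin 3) :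
    eval v (comp M (X i)) = ∑ j, M i j * v j := by
  simp [comp_X]

/-- A form of a reduced member of the family is a normal form. -/
theorem exists_eq_normalFormOf (hd : 1 ≤ d) {P : MvPolynomial (Fin 2) ℂ} (hP : P.IsHomogeneous d)
    {M : Matrix (Fin 3) (Fin 3) ℂ} {c : ℂ} {ω : Form d}
    (hω : ω = c • pullback M (normalForm P hP)) (hred : IsReduced ω) :
    ∃ a : ℕ → ℂ, a 0 = 0 ∧ a d ≠ 0 ∧ ω = normalFormOf d a := by
  obtain ⟨hA, hB, hZ, hD, hE, hC⟩ := id hred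
  have hω1 : ∀ j, ω.1 j = C c * (comp M (X 2) * pderiv j (comp M (pencilG d P)) -
      C ((d : ℂ) + 1) * comp M (pencilG d P) * C (M 2 j)) := fun j => by
    rw [hω, smul_form_apply, pullback_normalForm_eq]
  have hl : ∀ i, pderiv i (comp M (X 2)) = C (M 2 i) := fun i => by
    simp [comp_X, pderiv_X, Pi.single_apply, Derivation.leibniz]
  have hv : M.mulVec ![0, 1, 0] = ![M 0 1, M 1 1, M 2 1] := by
    ext k
    fin_cases k <;> simp [Matrix.mulVec, dotProduct, Fin.sum_univ_three]
  have hGx2 : eval ![0, 1, 0] (pderiv 0 (comp M (pencilG d P))) =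
      ∑ i, M i 0 * eval ![M 0 1, M 1 1, M 2 1] (pderiv i (pencilG d P)) := by
    rw [pderiv_comp, map_sum]
    refine Finset.sum_congr rfl fun i _ => ?_
    rw [map_mul, eval_C, eval_comp, hv]
  have hG2 : eval ![0, 1, 0] (comp M (pencilG d P)) =
      eval ![M 0 1, M 1 1, M 2 1] (pencilG d P) := by
    rw [eval_comp, hv]
  have hcomm := pderiv_comm 0 1 (comp M (pencilG d P))
  have hl3 : eval ![0, 0, 1] (comp M (X 2)) = M 2 2 := by
    rw [eval_comp_X]; simp [Fin.sum_univ_three]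
  have hl2 : eval ![0, 1, 0] (comp M (X 2)) = M 2 1 := by
    rw [eval_comp_X]; simp [Fin.sum_univ_three]
  simp only [dxAtZ_apply, hω1, map_mul, map_sub, eval_C, hl3] at hA
  simp only [dyAtZ, hω1, map_mul, map_sub, eval_C, hl3] at hB
  simp only [curlAtZ, hω1, Derivation.leibniz, hl, hcomm, map_mul, map_sub, map_add, eval_C,
    smul_eq_mul, pderiv_C, mul_zero, add_zero, map_zero] at hZ
  simp only [dxAtY, hω1, map_mul, map_sub, eval_C, hl2] at hD
  simp only [dzAtY, hω1, map_mul, map_sub, eval_C, hl2] at hC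
  simp only [dxDerivAtY, hω1, Derivation.leibniz, hl, map_mul, map_sub, map_add, eval_C,
    smul_eq_mul, pderiv_C, mul_zero, add_zero, map_zero, hl2] at hE
  have hd1 : (d : ℂ) + 1 ≠ 0 := Nat.cast_add_one_ne_zero d
  have hd2 := natCast_add_two_ne_zero d
  -- With l the pullback of z, ω = c (l dG − (d+1) G dl) gives (d+2) dl ∧ ω = l dω. At (0:0:1) the
  -- dx ∧ dy part of dω is zero while ω has dx- and dy-coefficients −1 and 0, so l has no y-term.
  have h21 : M 2 1 = 0 := by
    have : ((d : ℂ) + 2) * M 2 1 = 0 := by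
      linear_combination ((d : ℂ) + 2) * M 2 1 * hA - ((d : ℂ) + 2) * M 2 0 * hB + M 2 2 * hZ
    exact (mul_eq_zero.1 this).resolve_left hd2
  rw [h21] at hC hD hE hG2 hGx2
  have hc0 : c ≠ 0 := by
    rintro rfl
    simp at hC
  have h22 : M 2 2 ≠ 0 := by
    intro h
    simp [h] at hC
  have hGne : eval ![0, 1, 0] (comp M (pencilG d P)) ≠ 0 := by
    intro h
    simp [h] at hC
  -- Now l vanishes at (0:1:0), where ω = −c (d+1) G dl. Its dz-coefficient is nonzero, so c, G and
  -- `M 2 2` are nonzero, and its vanishing dx-coefficient removes the x-term of l.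
  have h20 : M 2 0 = 0 := by
    simpa [hc0, hd1, hGne] using hD
  rw [h20] at hE
  have hGx0 : eval ![0, 1, 0] (pderiv 0 (comp M (pencilG d P))) = 0 := by
    simpa [hc0, h22] using hE
  rw [hGx0, Fin.sum_univ_three, pderiv_zero_pencilG, pderiv_one_pencilG P hP, h20,
    eval_inYZ_of_z_eq_zero hP rfl] at hGx2
  rw [eval_pencilG_of_z_eq_zero hd rfl] at hG2
  rw [hG2] at hGne
  -- The derivative condition gives G_x = 0 at (0:1:0); there G_x is `M 1 0` times a_d `M 1 1`^d,
  -- and G ≠ 0 forces both a_d and `M 1 1` to be nonzero.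
  have h10 : M 1 0 = 0 := by
    have h := mul_ne_zero_iff.1 hGne
    have ha : coeffYZ d P d ≠ 0 := fun h0 => h.1 (by simp [h0])
    have h11 : M 1 1 ≠ 0 := fun h0 => h.2 (by simp [h0])
    simpa [ha, h11, show d ≠ 0 by omega] using hGx2
  have hcz : comp M (X 2) = C (M 2 2) * X 2 := by
    rw [comp_X, Fin.sum_univ_three, h20, h21]
    simp
  have hcy : comp M (X 1) = C (M 1 1) * X 1 + C (M 1 2) * X 2 := by
    rw [comp_X, Fin.sum_univ_three, h10]
    simp
  let e : MvPolynomial (Fin 2) ℂ →ₐ[ℂ] MvPolynomial (Fin 2) ℂ :=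
    aeval ![C (M 1 1) * X 0 + C (M 1 2) * X 1, C (M 2 2) * X 1]
  -- M is now upper triangular. The dx-coefficient of ω is a multiple of z^(d+1) and its
  -- dy-coefficient is z times this binary form, so ω is normal once the first constant is scaled.
  let P' : MvPolynomial (Fin 2) ℂ := C (-(c * M 0 1 * M 2 2 ^ (d + 1))) * X 1 ^ d +
    C (c * M 1 1 * M 2 2) * e P
  have heP : comp M (inYZ P) = inYZ (e P) := by
    have : (comp M).comp (rename ![1, 2]) = (rename ![1, 2]).comp e := by
      apply MvPolynomial.algHom_ext
      intro i
      fin_cases i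
      · simp [e, hcy]
      · simp [e, hcz]
    exact DFunLike.congr_fun this P
  have hP' : P'.IsHomogeneous d := by
    have h1 : (e P).IsHomogeneous d := by
      have := hP.aeval (![C (M 1 1) * X 0 + C (M 1 2) * X 1, C (M 2 2) * X 1] :
        Fin 2 → MvPolynomial (Fin 2) ℂ) (n := 1)
        (fun i => by
          have hX : ∀ (r : ℂ) (j : Fin 2),
              (C r * X j : MvPolynomial (Fin 2) ℂ).IsHomogeneous 1 := fun r j => by
            simpa using (isHomogeneous_C (Fin 2) r).mul (isHomogeneous_X ℂ j)
          match i with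
          | 0 => exact (hX (M 1 1) 0).add (hX (M 1 2) 1)
          | 1 => exact hX (M 2 2) 1)
      rwa [one_mul] at this
    refine IsHomogeneous.add ?_ ?_
    · simpa using (isHomogeneous_C (Fin 2) (-(c * M 0 1 * M 2 2 ^ (d + 1)))).mul
        (isHomogeneous_X_pow 1 d)
    · simpa using (isHomogeneous_C (Fin 2) (c * M 1 1 * M 2 2)).mul h1
  have hω0 : ω.1 0 = C (-(c * M 0 0 * M 2 2 ^ (d + 1))) * X 2 ^ (d + 1) := by
    rw [hω, smul_form_apply, pullback_apply, Fin.sum_univ_three, h10, h20, normalForm_zero,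
      map_neg, map_pow, hcz]
    simp only [C_0, zero_mul, add_zero, map_neg, map_mul, map_pow]
    ring
  have hω1' : ω.1 1 = X 2 * inYZ P' := by
    have : inYZ P' = C (-(c * M 0 1 * M 2 2 ^ (d + 1))) * X 2 ^ d +
        C (c * M 1 1 * M 2 2) * inYZ (e P) := by
      simp [inYZ, P']
    rw [hω, smul_form_apply, pullback_apply, Fin.sum_univ_three, h21, normalForm_zero,
      normalForm_one, map_neg, map_pow, map_mul, hcz, heP, this]
    simp only [C_0, zero_mul, add_zero, map_neg, map_mul, map_pow]
    ring
  have h1 : c * M 0 0 * M 2 2 ^ (d + 1) = 1 := by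
    have := hred.dxAtZ_eq
    rw [dxAtZ_apply, hω0] at this
    simpa using this
  have heq : ω = normalFormOf d (coeffYZ d P') := by
    rw [← normalForm_eq_normalFormOf hP']
    refine form_ext ?_ ?_
    · rw [hω0, normalForm_zero, h1]
      simp
    · rw [hω1', normalForm_one]
  refine ⟨_, ?_, ?_, heq⟩
  · rw [← dyAtZ_normalFormOf (d := d) (coeffYZ d P'), ← heq, hred.dyAtZ_eq]
  · have := hred.dzAtY_ne
    rw [heq, dzAtY_normalFormOf] at this
    exact neg_ne_zero.1 this

end Reduced

/-! ### The chart -/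

section Chart

variable {d : ℕ}

theorem curlAtZ_shearXY (t : ℂ) (ω : Form d) :
    curlAtZ (pullback (shearXY t) ω) = curlAtZ ω := by
  simp only [curlAtZ, pullback_apply, Fin.sum_univ_three, map_add, map_sub,
    Derivation.leibniz, pderiv_C, pderiv_comp, smul_eq_mul, map_mul, eval_C, eval_comp,
    mulVec_shear, mul_zero, add_zero]
  simp [shearXY]

/-- The curl is zero before and after the first shear, so the second is the identity. The first
moves (0,1,0) to (t,1,0), where x z^d − y P is still −a_d. No condition on a_0 is involved, so every
normal foliation of the family lies in the chart domain. -/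
theorem dzAtY_reduceZY_reduceXY_normalFormOf (hd : 1 ≤ d) (a : ℕ → ℂ) :
    dzAtY (reduceZY (reduceXY (normalFormOf d a))) = -a d := by
  have h0 : ∀ t, curlAtZ (pullback (shearXY t) (normalFormOf d a)) = 0 := fun t => by
    rw [curlAtZ_shearXY, curlAtZ_normalFormOf]
  have h1 : shearZY 0 = 1 := by
    ext i j
    fin_cases i <;> fin_cases j <;> simp [shearZY]
  have hv : ∀ t, (shearXY t).mulVec ![0, 1, 0] = ![t, 1, 0] := fun t => by
    ext i
    fin_cases i <;> simp [shearXY, Matrix.mulVec, dotProduct, Fin.sum_univ_three]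
  rw [reduceXY, reduceZY, paramZY, h0, neg_zero, zero_div, h1, pullback_one, dzAtY]
  generalize paramXY (normalFormOf d a) = t
  have h2 : (pullback (shearXY t) (normalFormOf d a)).1 2 =
      comp (shearXY t) ((normalFormOf d a).1 2) := by
    rw [pullback_apply, Fin.sum_univ_three]
    simp [shearXY]
  rw [h2, eval_comp, hv, normalFormOf, normalForm_two, map_sub, map_mul, map_mul,
    eval_inYZ_of_z_eq_zero (binaryForm_isHomogeneous d a) rfl, coeffYZ_binaryForm a le_rfl]
  simp [show d ≠ 0 by omega]

/-- The coefficients of the binary form `B / z`, where `B` is the coefficient of `dy`, except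
the first one. -/
def readCoeffs (ω : Form d) (i : ℕ) : ℂ :=
  -- Reduced normal forms have a_0 = 0. The exponent of z is d − i + 1 because the dy-coefficient is
  -- z P.
  if i = 0 then 0 else coeff (Finsupp.single 1 i + Finsupp.single 2 (d - i + 1)) (ω.1 1)

theorem readCoeffs_normalFormOf {a : ℕ → ℂ} (h0 : a 0 = 0) {i : ℕ} (hi : i ≤ d) :
    readCoeffs (normalFormOf d a) i = a i := by
  rw [readCoeffs]
  split_ifs with h
  · rw [h, h0]
  have h1 : (Finsupp.single 1 i + Finsupp.single 2 (d - i + 1) : Fin 3 →₀ ℕ) =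
      Finsupp.single 2 1 + Finsupp.mapDomain ![1, 2]
        (Finsupp.single 0 i + Finsupp.single 1 (d - i) : Fin 2 →₀ ℕ) := by
    rw [Finsupp.mapDomain_add, Finsupp.mapDomain_single, Finsupp.mapDomain_single,
      Finsupp.single_add]
    simp only [Matrix.cons_val_zero, Matrix.cons_val_one]
    abel
  have hinj : Function.Injective (![1, 2] : Fin 2 → Fin 3) := by decide
  rw [h1, normalFormOf, normalForm_one, coeff_X_mul, inYZ, coeff_rename_mapDomain _ hinj,
    coeff_binaryForm]
  simp [hi]

/-- The matrix of the change of coordinates that undoes the reduction. -/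
def unreduceMatrix (t₁ t₂ t₃ t₄ : ℂ) : Matrix (Fin 3) (Fin 3) ℂ :=
  shearYX (-t₄) * shearZX (-t₃) * shearZY (-t₂) * shearXY (-t₁)

theorem unreduce_eq_pullback (t₁ t₂ t₃ t₄ : ℂ) (ω : Form d) :
    unreduce t₁ t₂ t₃ t₄ ω = pullback (unreduceMatrix t₁ t₂ t₃ t₄) ω := by
  simp only [unreduce, unreduceMatrix, pullback_pullback, mul_assoc]

theorem det_unreduceMatrix (t₁ t₂ t₃ t₄ : ℂ) : (unreduceMatrix t₁ t₂ t₃ t₄).det = 1 := by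
  simp [unreduceMatrix, shearYX, shearZX, shearZY, shearXY, Matrix.det_fin_three]
  ring

theorem reduce_eq_pullback (ω : Form d) : reduce ω =
    pullback (shearXY (paramXY ω) * shearZY (paramZY (reduceXY ω)) *
      shearZX (paramZX (reduceZY (reduceXY ω))) *
      shearYX (paramYX (reduceZX (reduceZY (reduceXY ω))))) ω := by
  simp only [← pullback_pullback]
  rfl

/-- The representative of a point at which the coefficient of `dx` is `-1` at `(0 : 0 : 1)`. -/
def normalize (x : ℙ ℂ (Form d)) : Form d := (-(dxAtZ x.rep)⁻¹) • x.rep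

theorem dxAtZ_normalize {x : ℙ ℂ (Form d)} (h : dxAtZ x.rep ≠ 0) : dxAtZ (normalize x) = -1 := by
  rw [normalize, map_smul, smul_eq_mul, neg_mul, inv_mul_cancel₀ h]

theorem normalize_mk {v : Form d} (hv : v ≠ 0) (h : dxAtZ v = -1) :
    dxAtZ (Projectivization.mk ℂ v hv).rep ≠ 0 ∧ normalize (Projectivization.mk ℂ v hv) = v := by
  obtain ⟨c, hc⟩ := Projectivization.exists_smul_eq_mk_rep ℂ v hv
  have hc' : (Projectivization.mk ℂ v hv).rep = (c : ℂ) • v := hc.symm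
  rw [normalize, hc', map_smul, h, smul_smul]
  simp

theorem mk_normalize {x : ℙ ℂ (Form d)} (h : dxAtZ x.rep ≠ 0) :
    ∃ hv : normalize x ≠ 0, x = Projectivization.mk ℂ (normalize x) hv := by
  rw [normalize]
  have h0 : -(dxAtZ x.rep)⁻¹ ≠ 0 := neg_ne_zero.2 (inv_ne_zero h)
  refine ⟨smul_ne_zero h0 x.rep_nonzero, ?_⟩
  conv_lhs => rw [← x.mk_rep]
  rw [Projectivization.mk_eq_mk_iff']
  refine ⟨(-(dxAtZ x.rep)⁻¹)⁻¹, ?_⟩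
  rw [inv_smul_smul₀ h0]

variable (d) in
/-- The first open condition on the domain of the chart. -/
def preChartDomain : Set (ℙ ℂ (Form d)) := {x | dxAtZ x.rep ≠ 0}

variable (d) in
/-- The domain of the chart. -/
def chartDomain : Set (ℙ ℂ (Form d)) :=
  {x | x ∈ preChartDomain d ∧ dzAtY (reduceZY (reduceXY (normalize x))) ≠ 0}

theorem chartDomain_subset : chartDomain d ⊆ preChartDomain d := fun _ hx => hx.1

section Regular

variable {Y : Type*} {𝒜 : Subalgebra ℂ (Y → ℂ)}

theorem const_mem (c : ℂ) : (fun _ => c) ∈ 𝒜 := 𝒜.algebraMap_mem c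

theorem shear_mem {t : Y → ℂ} (ht : t ∈ 𝒜) :
    (∀ i j, (fun y => shearXY (t y) i j) ∈ 𝒜) ∧ (∀ i j, (fun y => shearZY (t y) i j) ∈ 𝒜) ∧
    (∀ i j, (fun y => shearZX (t y) i j) ∈ 𝒜) ∧ (∀ i j, (fun y => shearYX (t y) i j) ∈ 𝒜) := by
  refine ⟨?_, ?_, ?_, ?_⟩ <;> intro i j <;> fin_cases i <;> fin_cases j <;>
    first | exact ht | exact const_mem 0 | exact const_mem 1

theorem formCoeffsIn_normalFormOf {a : Y → ℕ → ℂ} (ha : ∀ i, (fun y => a y i) ∈ 𝒜) :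
    FormCoeffsIn 𝒜 fun y => normalFormOf d (a y) := by
  have h : CoeffsIn 𝒜 fun y => inYZ (binaryForm d (a y)) := by
    simp only [inYZ_binaryForm]
    exact .sum _ fun i _ => .mul (.mul (.C (ha i)) (.const _)) (.const _)
  intro i
  match i with
  | 0 =>
    simp only [normalFormOf, normalForm_zero]
    exact .const _
  | 1 =>
    simp only [normalFormOf, normalForm_one]
    exact .mul (.const _) h
  | 2 =>
    simp only [normalFormOf, normalForm_two]
    exact .sub (.const _) (.mul (.const _) h)

theorem FormCoeffsIn.unreduce {ω : Y → Form d} {t₁ t₂ t₃ t₄ : Y → ℂ} (h₁ : t₁ ∈ 𝒜) (h₂ : t₂ ∈ 𝒜)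
    (h₃ : t₃ ∈ 𝒜) (h₄ : t₄ ∈ 𝒜) (hω : FormCoeffsIn 𝒜 ω) :
    FormCoeffsIn 𝒜 fun y => PlaneFoliation.unreduce (t₁ y) (t₂ y) (t₃ y) (t₄ y) (ω y) :=
  (((hω.pullback (shear_mem (𝒜.neg_mem h₄)).2.2.2).pullback
    (shear_mem (𝒜.neg_mem h₃)).2.2.1).pullback (shear_mem (𝒜.neg_mem h₂)).2.1).pullback
    (shear_mem (𝒜.neg_mem h₁)).1

variable {ω : Y → Form d} (hω : FormCoeffsIn 𝒜 ω)

include hω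

theorem FormCoeffsIn.eval_mem (v : Fin 3 → ℂ) (i : Fin 3) :
    (fun y => eval v ((ω y).1 i)) ∈ 𝒜 :=
  (hω i).linear_mem (fun y => (ω y).2.1 i) (aeval v).toLinearMap

theorem FormCoeffsIn.eval_pderiv_mem (v : Fin 3 → ℂ) (i j : Fin 3) :
    (fun y => eval v (pderiv j ((ω y).1 i))) ∈ 𝒜 :=
  (hω i).linear_mem (fun y => (ω y).2.1 i) ((aeval v).toLinearMap ∘ₗ (pderiv j).toLinearMap)

theorem FormCoeffsIn.paramXY_mem : (fun y => paramXY (ω y)) ∈ 𝒜 := hω.eval_mem _ _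

theorem FormCoeffsIn.paramZY_mem : (fun y => paramZY (ω y)) ∈ 𝒜 := by
  have := 𝒜.mul_mem (𝒜.sub_mem (hω.eval_pderiv_mem ![0, 0, 1] 0 1)
    (hω.eval_pderiv_mem ![0, 0, 1] 1 0)) (const_mem ((d : ℂ) + 2)⁻¹)
  convert this using 2 with y
  simp only [paramZY, curlAtZ, map_sub, Pi.mul_apply, Pi.sub_apply]
  ring

theorem FormCoeffsIn.reduceXY : FormCoeffsIn 𝒜 fun y => PlaneFoliation.reduceXY (ω y) :=
  hω.pullback (shear_mem hω.paramXY_mem).1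

theorem FormCoeffsIn.reduceZY : FormCoeffsIn 𝒜 fun y => PlaneFoliation.reduceZY (ω y) :=
  hω.pullback (shear_mem hω.paramZY_mem).2.1

theorem FormCoeffsIn.readCoeffs_mem (i : ℕ) : (fun y => readCoeffs (ω y) i) ∈ 𝒜 := by
  simp only [readCoeffs]
  split_ifs
  · exact const_mem 0
  · exact hω 1 _

end Regular

/-- Each coefficient is minus a quotient of two linear forms on `Form d`, with denominator nonzero
on this domain. -/
theorem formCoeffsIn_normalize : FormCoeffsIn (regularFunctions (preChartDomain d)) normalize := by
  intro i m
  have := (regularFunctions (preChartDomain d)).neg_mem (linear_div_mem_regularFunctions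
    (lcoeff ℂ m ∘ₗ LinearMap.proj i ∘ₗ (Form d).subtype) dxAtZ fun x hx => hx)
  convert this using 2 with x
  simp only [normalize, smul_form_apply, coeff_C_mul, Pi.neg_apply]
  simp [lcoeff]
  ring

end Chart

/-! ### Chart coordinates, local equations and dimension -/

section Coordinates

variable {d : ℕ}

/-- The coordinates of the chart: the four parameters of the reduction, and the coefficients of the
normal form. -/
def chartCoords (x : ℙ ℂ (Form d)) : Fin 4 ⊕ Fin d → ℂ :=
  Sum.elim ![paramXY (normalize x), paramZY (reduceXY (normalize x)),
    paramZX (reduceZY (reduceXY (normalize x))),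
    paramYX (reduceZX (reduceZY (reduceXY (normalize x))))]
    -- The shift by one omits a_0, leaving a_1, …, a_d.
    fun j => readCoeffs (reduce (normalize x)) (j + 1)

/-- The coefficients of the normal form with the given coordinates. -/
def coeffsOfCoords (b : Fin 4 ⊕ Fin d → ℂ) (i : ℕ) : ℂ :=
  if h : 0 < i ∧ i ≤ d then b (.inr ⟨i - 1, by omega⟩) else 0

/-- The inverse of the chart. -/
def chartInv (b : Fin 4 ⊕ Fin d → ℂ) : Form d :=
  unreduce (b (.inl 0)) (b (.inl 1)) (b (.inl 2)) (b (.inl 3)) (normalFormOf d (coeffsOfCoords b))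

theorem coeffsOfCoords_chartCoords (x : ℙ ℂ (Form d)) {i : ℕ} (hi : i ≤ d) :
    coeffsOfCoords (chartCoords x) i = readCoeffs (reduce (normalize x)) i := by
  rw [coeffsOfCoords]
  split_ifs with h
  · simp only [chartCoords, Sum.elim_inr]
    rw [Nat.sub_add_cancel h.1]
  · have : i = 0 := by omega
    simp [readCoeffs, this]

theorem regular_reduceZY_reduceXY : FormCoeffsIn (regularFunctions (preChartDomain d)) fun x =>
    reduceZY (reduceXY (normalize x)) := formCoeffsIn_normalize.reduceXY.reduceZY

theorem isOpen_preChartDomain : IsOpen (X := FoliationSpace d) (preChartDomain d) :=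
  isOpen_linear_ne_zero dxAtZ

theorem isOpen_chartDomain : IsOpen (X := FoliationSpace d) (chartDomain d) :=
  isOpen_ne_zero_of_mem_regularFunctions isOpen_preChartDomain
    (regular_reduceZY_reduceXY.eval_mem ![0, 1, 0] 2)

theorem FormCoeffsIn.mono {Y : Type*} {𝒜 ℬ : Subalgebra ℂ (Y → ℂ)} (h : 𝒜 ≤ ℬ) {ω : Y → Form d}
    (hω : FormCoeffsIn 𝒜 ω) : FormCoeffsIn ℬ ω := fun i m => h (hω i m)

theorem formCoeffsIn_of_preChartDomain {ω : ℙ ℂ (Form d) → Form d}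
    (hω : FormCoeffsIn (regularFunctions (preChartDomain d)) ω) :
    FormCoeffsIn (regularFunctions (chartDomain d)) ω :=
  hω.mono fun _ hf => regularFunctions_mono chartDomain_subset hf

/-- Beyond the initial normalization, this is the first parameter with a nonconstant denominator;
the second condition defining `chartDomain` makes it nonzero. -/
theorem paramZX_mem : (fun x => paramZX (reduceZY (reduceXY (normalize x)))) ∈
    regularFunctions (chartDomain d) := by
  have h := formCoeffsIn_of_preChartDomain (regular_reduceZY_reduceXY (d := d))
  exact div_mem_regularFunctions ((regularFunctions _).neg_mem (h.eval_mem ![0, 1, 0] 0))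
    (h.eval_mem ![0, 1, 0] 2) fun x hx => hx.2

theorem regular_reduceZX : FormCoeffsIn (regularFunctions (chartDomain d)) fun x =>
    reduceZX (reduceZY (reduceXY (normalize x))) :=
  (formCoeffsIn_of_preChartDomain regular_reduceZY_reduceXY).pullback (shear_mem paramZX_mem).2.2.1

theorem paramYX_mem : (fun x => paramYX (reduceZX (reduceZY (reduceXY (normalize x))))) ∈
    regularFunctions (chartDomain d) := by
  refine div_mem_regularFunctions (regular_reduceZX.eval_pderiv_mem ![0, 1, 0] 0 2)
    (regular_reduceZX.eval_mem ![0, 1, 0] 2) fun x hx => ?_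
  have := hx.2
  rw [← dzAtY_shearZX (paramZX (reduceZY (reduceXY (normalize x))))] at this
  exact this

theorem regular_reduce :
    FormCoeffsIn (regularFunctions (chartDomain d)) fun x => reduce (normalize x) :=
  regular_reduceZX.pullback (shear_mem paramYX_mem).2.2.2

theorem chartCoords_mem (k : Fin 4 ⊕ Fin d) :
    (fun x => chartCoords x k) ∈ regularFunctions (chartDomain d) := by
  rcases k with k | j
  · match k with
    | 0 => exact (formCoeffsIn_of_preChartDomain formCoeffsIn_normalize).paramXY_mem
    | 1 => exact (formCoeffsIn_of_preChartDomain formCoeffsIn_normalize).reduceXY.paramZY_mem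
    | 2 => exact paramZX_mem
    | 3 => exact paramYX_mem
  · exact regular_reduce.readCoeffs_mem ((j : ℕ) + 1)

theorem formCoeffsIn_chartInv : FormCoeffsIn (polyFunctions (Fin 4 ⊕ Fin d)) chartInv := by
  refine .unreduce (coord_mem_polyFunctions _) (coord_mem_polyFunctions _)
    (coord_mem_polyFunctions _) (coord_mem_polyFunctions _) (formCoeffsIn_normalFormOf fun i => ?_)
  simp only [coeffsOfCoords]
  split_ifs
  · exact coord_mem_polyFunctions _
  · exact const_mem 0

theorem isReduced_of_mem_chartDomain {x : ℙ ℂ (Form d)} (hx : x ∈ chartDomain d) :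
    IsReduced (reduce (normalize x)) := isReduced_reduce (dxAtZ_normalize hx.1) hx.2

/-- Turns membership into equations in regular functions. Reduction stays within the family up to a
scalar, so `exists_eq_normalFormOf` applies to the reduced form; conversely, undoing the shears of a
normal form stays in the family. -/
theorem mem_orbitFamily_iff (hd : 1 ≤ d) {x : ℙ ℂ (Form d)} (hx : x ∈ chartDomain d) :
    (x : FoliationSpace d) ∈ orbitFamily d ↔
      reduce (normalize x) = normalFormOf d (readCoeffs (reduce (normalize x))) := by
  constructor
  · intro h
    obtain ⟨P, hP, g, c, -, -, hc⟩ := exists_form_of_mem_orbitFamily h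
    have hc' : x.rep = c • pullback g.1 (normalForm P hP) := hc
    have hred := isReduced_of_mem_chartDomain hx
    have heq := reduce_eq_pullback (normalize x)
    -- Only the form being pulled back is unfolded; the occurrences inside the shear parameters are
    -- left alone.
    nth_rw 6 [normalize] at heq
    rw [hc', smul_smul, pullback_smul, pullback_pullback] at heq
    obtain ⟨a, h0, -, ha⟩ := exists_eq_normalFormOf hd hP heq hred
    rw [ha]
    exact normalFormOf_congr fun i hi => (readCoeffs_normalFormOf h0 hi).symm
  · intro h
    obtain ⟨hv, hx'⟩ := mk_normalize hx.1
    have hne := (isReduced_of_mem_chartDomain hx).dzAtY_ne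
    rw [h, dzAtY_normalFormOf] at hne
    rw [hx']
    refine mk_mem_orbitFamily (binaryForm_isHomogeneous d (readCoeffs (reduce (normalize x)))) ?_
      (M := unreduceMatrix (paramXY (normalize x)) (paramZY (reduceXY (normalize x)))
        (paramZX (reduceZY (reduceXY (normalize x))))
        (paramYX (reduceZX (reduceZY (reduceXY (normalize x)))))) ?_ (c := 1) hv ?_
    · rw [atZZero_ne_zero_iff (binaryForm_isHomogeneous d _), coeffYZ_binaryForm _ le_rfl]
      exact neg_ne_zero.1 hne
    · rw [det_unreduceMatrix]
      exact one_ne_zero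
    · rw [one_smul, ← unreduce_eq_pullback]
      conv_lhs => rw [← unreduce_reduce (normalize x), h]
      rfl

theorem chartInv_chartCoords (hd : 1 ≤ d) {x : ℙ ℂ (Form d)} (hx : x ∈ chartDomain d)
    (hxS : (x : FoliationSpace d) ∈ orbitFamily d) : chartInv (chartCoords x) = normalize x := by
  have h := (mem_orbitFamily_iff hd hx).1 hxS
  rw [chartInv, normalFormOf_congr fun i hi => coeffsOfCoords_chartCoords x hi, ← h]
  exact unreduce_reduce (normalize x)

variable (d) in
/-- The last coefficient of the normal form, which does not vanish. -/
def lastCoord (hd : 1 ≤ d) : MvPolynomial (Fin 4 ⊕ Fin d) ℂ := X (.inr ⟨d - 1, by omega⟩)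

theorem eval_lastCoord (hd : 1 ≤ d) (b : Fin 4 ⊕ Fin d → ℂ) :
    eval b (lastCoord d hd) = coeffsOfCoords b d := by
  rw [lastCoord, eval_X, coeffsOfCoords, dif_pos ⟨hd, le_rfl⟩]

/-- A normal form with a_0 = 0 and a_d ≠ 0 is reduced, so `reduce_unreduce` recovers both the four
parameters and the form: the chart is onto {a_d ≠ 0}. -/
theorem chart_chartInv (hd : 1 ≤ d) {b : Fin 4 ⊕ Fin d → ℂ} (hb : eval b (lastCoord d hd) ≠ 0) :
    ∃ hv : chartInv b ≠ 0, (Projectivization.mk ℂ (chartInv b) hv : FoliationSpace d) ∈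
      orbitFamily d ∩ chartDomain d ∧ chartCoords (Projectivization.mk ℂ (chartInv b) hv) = b := by
  have h0 : coeffsOfCoords b 0 = 0 := by simp [coeffsOfCoords]
  rw [eval_lastCoord] at hb
  obtain ⟨h1, h2, h3, h4, h5, h6, h7⟩ := reduce_unreduce (isReduced_normalFormOf hd h0 hb)
    (b (.inl 0)) (b (.inl 1)) (b (.inl 2)) (b (.inl 3))
  have hv : chartInv b ≠ 0 := by
    intro h
    rw [← chartInv, h, map_zero] at h1
    norm_num at h1
  obtain ⟨h8, h9⟩ := normalize_mk hv h1
  refine ⟨hv, ⟨?_, h8, ?_⟩, ?_⟩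
  · refine mk_mem_orbitFamily (binaryForm_isHomogeneous d (coeffsOfCoords b)) ?_
      (M := unreduceMatrix (b (.inl 0)) (b (.inl 1)) (b (.inl 2)) (b (.inl 3))) ?_ (c := 1) hv ?_
    · rwa [atZZero_ne_zero_iff (binaryForm_isHomogeneous d _), coeffYZ_binaryForm _ le_rfl]
    · rw [det_unreduceMatrix]
      exact one_ne_zero
    · rw [one_smul, ← unreduce_eq_pullback]
      rfl
  · rw [h9]
    refine (h2.trans (dzAtY_normalFormOf _)).trans_ne (neg_ne_zero.2 hb)
  · ext k
    rcases k with k | j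
    · simp only [chartCoords, h9, Sum.elim_inl]
      match k with
      | 0 => exact h3
      | 1 => exact h4
      | 2 => exact h5
      | 3 => exact h6
    · simp only [chartCoords, h9, Sum.elim_inr]
      rw [chartInv, h7, readCoeffs_normalFormOf h0 (by omega), coeffsOfCoords,
        dif_pos ⟨by omega, by omega⟩]
      simp

/-- The equations of `mem_orbitFamily_iff`, taken coefficient by coefficient, are the vanishing of
regular functions on the chart domain. -/
theorem exists_isClosed_orbitFamily (hd : 1 ≤ d) : ∃ Z : Set (FoliationSpace d), IsClosed Z ∧
    ∀ x ∈ chartDomain d, x ∈ orbitFamily d ↔ x ∈ Z := by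
  obtain ⟨Z, hZ, h⟩ := exists_isClosed_forall (O := chartDomain d)
    (f := fun (k : Fin 3 × (Fin 3 →₀ ℕ)) x => coeff k.2 ((reduce (normalize x)).1 k.1) -
      coeff k.2 ((normalFormOf d (readCoeffs (reduce (normalize x)))).1 k.1)) fun k =>
    (regularFunctions _).sub_mem (regular_reduce k.1 k.2)
      (formCoeffsIn_normalFormOf (fun i => regular_reduce.readCoeffs_mem i) k.1 k.2)
  refine ⟨Z, hZ, fun x hx => ?_⟩
  rw [mem_orbitFamily_iff hd hx]
  refine Iff.trans ?_ (h x hx)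
  simp only [sub_eq_zero, Prod.forall]
  constructor
  · intro h i m
    rw [← h]
  · intro h
    exact Subtype.ext (funext fun i => MvPolynomial.ext _ _ fun m => h i m)

theorem exists_smul_mem_chartDomain (hd : 1 ≤ d) {F : FoliationSpace d} (hF : F ∈ orbitFamily d) :
    ∃ g : SL(3, ℂ), g • F ∈ chartDomain d := by
  obtain ⟨P, hP, ha, g, rfl⟩ := hF
  -- Translating back gives the normal foliation itself, which lies in the chart domain.
  refine ⟨g⁻¹, ?_⟩
  simp only [inv_smul_smul]
  have hv : normalForm P hP ≠ 0 := normalField_toForm_ne_zero P hP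
  obtain ⟨h1, h2⟩ := normalize_mk hv (by rw [normalForm_eq_normalFormOf, dxAtZ_normalFormOf])
  refine ⟨h1, ?_⟩
  have h2' : normalize (normalFoliation P hP) = normalForm P hP := h2
  rw [h2', normalForm_eq_normalFormOf, dzAtY_reduceZY_reduceXY_normalFormOf hd]
  exact neg_ne_zero.2 ((atZZero_ne_zero_iff hP).1 ha)

theorem topologicalKrullDim_orbitFamily (hd : 1 ≤ d) :
    topologicalKrullDim (orbitFamily d) = ((d + 4 : ℕ) : WithBot ℕ∞) := by
  rw [topologicalKrullDim_eq_of_translates continuous_smul_foliationSpace isOpen_chartDomain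
    (fun g x hx => smul_mem_orbitFamily g hx) fun x hx => exists_smul_mem_chartDomain hd hx]
  have hcard : Fintype.card (Fin 4 ⊕ Fin d) = d + 4 := by
    simp [add_comm]
  have hinv : ∀ x ∈ (orbitFamily d ∩ chartDomain d : Set (FoliationSpace d)),
      ∃ hv : chartInv (chartCoords x) ≠ 0,
        x = Projectivization.mk ℂ (chartInv (chartCoords x)) hv := by
    rintro x ⟨hxS, hxO⟩
    rw [chartInv_chartCoords hd hxO hxS]
    exact mk_normalize hxO.1
  rw [← hcard]
  apply le_antisymm
  · exact topologicalKrullDim_le_of_chart Set.inter_subset_right chartCoords chartCoords_mem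
      chartInv formCoeffsIn_chartInv.dual_mem hinv
  · refine le_topologicalKrullDim_of_chart Set.inter_subset_right chartCoords chartCoords_mem
      chartInv formCoeffsIn_chartInv.dual_mem (lastCoord d hd) (X_ne_zero _)
      (fun x hx => ⟨?_, hinv x hx⟩) fun b hb => chart_chartInv hd hb
    have hne := (isReduced_of_mem_chartDomain hx.2).dzAtY_ne
    rw [(mem_orbitFamily_iff hd hx.2).1 hx.1, dzAtY_normalFormOf] at hne
    rw [eval_lastCoord, coeffsOfCoords_chartCoords x le_rfl]
    exact neg_ne_zero.1 hne

theorem isLocallyClosed_orbitFamily (hd : 1 ≤ d) : IsLocallyClosed (orbitFamily d) := by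
  obtain ⟨Z, hZ, h⟩ := exists_isClosed_orbitFamily hd
  exact isLocallyClosed_of_translates continuous_smul_foliationSpace isOpen_chartDomain
    (fun g x hx => smul_mem_orbitFamily g hx) (fun x hx => exists_smul_mem_chartDomain hd hx) hZ h

/-! ### Irreducibility -/

/-- The matrix part of the parameters of the family. -/
def paramMatrix (b : (Fin 3 × Fin 3) ⊕ Fin (d + 1) → ℂ) : Matrix (Fin 3) (Fin 3) ℂ :=
  Matrix.of fun i j => b (.inl (i, j))

/-- The coefficients of the binary form in the parameters of the family. -/
def paramCoeffs (b : (Fin 3 × Fin 3) ⊕ Fin (d + 1) → ℂ) (i : ℕ) : ℂ :=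
  if h : i < d + 1 then b (.inr ⟨i, h⟩) else 0

/-- The member of the family with the given parameters. -/
def paramForm (b : (Fin 3 × Fin 3) ⊕ Fin (d + 1) → ℂ) : Form d :=
  pullback (paramMatrix b) (normalFormOf d (paramCoeffs b))

variable (d) in
/-- The open condition on the parameters. -/
def paramPoly : MvPolynomial ((Fin 3 × Fin 3) ⊕ Fin (d + 1)) ℂ :=
  (Matrix.of fun i j => X (.inl (i, j)) : Matrix (Fin 3) (Fin 3) _).det * X (.inr (Fin.last d))

theorem eval_paramPoly (b : (Fin 3 × Fin 3) ⊕ Fin (d + 1) → ℂ) :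
    eval b (paramPoly d) = (paramMatrix b).det * paramCoeffs b d := by
  rw [paramPoly, map_mul, RingHom.map_det, eval_X, paramCoeffs, dif_pos d.lt_succ_self]
  congr 2
  ext i j
  simp [paramMatrix]

theorem pullback_injective {M : Matrix (Fin 3) (Fin 3) ℂ} (hM : IsUnit M.det) :
    Function.Injective (pullback M : Form d → Form d) := by
  refine Function.LeftInverse.injective (g := pullback M⁻¹) fun ω => ?_
  rw [pullback_pullback, Matrix.mul_nonsing_inv _ hM, pullback_one]

/-- All 3×3 matrices and all binary forms are used as parameters, instead of SL(3), so that the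
source is an affine space; the condition det M · a_d ≠ 0 is a single basic open one. -/
theorem isIrreducible_orbitFamily : IsIrreducible (orbitFamily d) := by
  have hpoly : FormCoeffsIn (polyFunctions ((Fin 3 × Fin 3) ⊕ Fin (d + 1)))
      (paramForm : _ → Form d) := by
    refine (formCoeffsIn_normalFormOf fun i => ?_).pullback fun i j => coord_mem_polyFunctions _
    simp only [paramCoeffs]
    split_ifs
    · exact coord_mem_polyFunctions _
    · exact const_mem 0
  have hne : ∀ b, eval b (paramPoly d) ≠ 0 → paramForm b ≠ 0 := by
    intro b hb h
    rw [eval_paramPoly, mul_ne_zero_iff] at hb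
    have h0 : pullback (paramMatrix b) (0 : Form d) = 0 := by
      simpa using pullback_smul (paramMatrix b) 0 (0 : Form d)
    exact normalField_toForm_ne_zero _ _ (pullback_injective hb.1.isUnit (h.trans h0.symm))
  have exists_param : ∀ (M : Matrix (Fin 3) (Fin 3) ℂ) (a : ℕ → ℂ),
      ∃ b : (Fin 3 × Fin 3) ⊕ Fin (d + 1) → ℂ,
        paramMatrix b = M ∧ ∀ i ≤ d, paramCoeffs b i = a i :=
    fun M a => ⟨Sum.elim (fun p => M p.1 p.2) fun i => a i, rfl, fun i hi => by
      simp [paramCoeffs, Nat.lt_succ_of_le hi]⟩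
  have h0 : paramPoly d ≠ 0 := by
    intro h
    obtain ⟨b, hb, hb'⟩ := exists_param 1 1
    have := eval_paramPoly b
    rw [h, hb, hb' d le_rfl] at this
    simp at this
  have himg := isIrreducible_image paramForm hpoly.dual_mem (paramPoly d) h0 hne
  suffices heq : orbitFamily d = {F : FoliationSpace d | ∃ b, ∃ hb : eval b (paramPoly d) ≠ 0,
      F = Projectivization.mk ℂ (paramForm b) (hne b hb)} by
    rw [heq]
    exact himg
  ext F
  constructor
  · intro hF
    obtain ⟨P, hP, g, c, ha, hc, hform⟩ := exists_form_of_mem_orbitFamily hF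
    obtain ⟨b, hb, hb'⟩ := exists_param g.1 (coeffYZ d P)
    have hb0 : eval b (paramPoly d) ≠ 0 := by
      rw [eval_paramPoly, hb, hb' d le_rfl]
      exact mul_ne_zero (det_coe_ne_zero g) ((atZZero_ne_zero_iff hP).1 ha)
    refine ⟨b, hb0, ?_⟩
    have hF' : F = Projectivization.mk ℂ F.form F.rep_nonzero := (Projectivization.mk_rep F).symm
    rw [hF']
    refine (Projectivization.mk_eq_mk_iff' ℂ _ _ _ _).2 ⟨c, ?_⟩
    rw [hform, paramForm, hb, normalFormOf_congr hb', normalForm_eq_normalFormOf]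
  · rintro ⟨b, hb, rfl⟩
    have hb' := hb
    rw [eval_paramPoly, mul_ne_zero_iff] at hb'
    refine mk_mem_orbitFamily (binaryForm_isHomogeneous d (paramCoeffs b)) ?_
      (M := paramMatrix b) hb'.1 (c := 1) (hne b hb) (one_smul _ _).symm
    rw [atZZero_ne_zero_iff (binaryForm_isHomogeneous d _), coeffYZ_binaryForm _ le_rfl]
    exact hb'.2

end Coordinates

end PlaneFoliation
end

open PlaneFoliation in
theorem mainTheorem9 (d : ℕ) (hd : 1 ≤ d) :
    IsIrreducible (orbitFamily d) ∧
    IsLocallyClosed (orbitFamily d) ∧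
    topologicalKrullDim (orbitFamily d) = ((d + 4 : ℕ) : WithBot ℕ∞) ∧
    (∀ F ∈ orbitFamily d, F.NoCommonFactor ∧ (∃! p, p ∈ F.singularSet) ∧
      ∃ G H : Poly3, F.IsRationalFirstIntegral (d + 1) G H) ∧
    (∀ (P : MvPolynomial (Fin 2) ℂ) (hP : P.IsHomogeneous d), atZZero P ≠ 0 →
      (normalFoliation P hP).IsRationalFirstIntegral (d + 1) (pencilG d P) (X 2 ^ (d + 1)) ∧
      ∀ g : Matrix.SpecialLinearGroup (Fin 3) ℂ,
        (g • normalFoliation P hP).IsRationalFirstIntegral (d + 1)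
          (comp (g⁻¹).1 (pencilG d P)) (comp (g⁻¹).1 (X 2 ^ (d + 1)))) := by
  have hpencil : ∀ (P : MvPolynomial (Fin 2) ℂ) (hP : P.IsHomogeneous d), atZZero P ≠ 0 →
      ∀ g : Matrix.SpecialLinearGroup (Fin 3) ℂ,
        (g • normalFoliation P hP).IsRationalFirstIntegral (d + 1)
          (comp (g⁻¹).1 (pencilG d P)) (comp (g⁻¹).1 (X 2 ^ (d + 1))) := by
    intro P hP ha g
    obtain ⟨c, hc, h⟩ := exists_form_smul_normalFoliation P hP g
    exact isRationalFirstIntegral_of_form_eq hP (det_coe_ne_zero _).isUnit hc h hd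
      ((atZZero_ne_zero_iff hP).1 ha)
  refine ⟨isIrreducible_orbitFamily, isLocallyClosed_orbitFamily hd,
    topologicalKrullDim_orbitFamily hd, fun F hF => ?_, fun P hP ha => ⟨?_, hpencil P hP ha⟩⟩
  · obtain ⟨P, hP, g, c, ha, hc, h⟩ := exists_form_of_mem_orbitFamily hF
    have ha' := (atZZero_ne_zero_iff hP).1 ha
    have hg := (det_coe_ne_zero g).isUnit
    exact ⟨noCommonFactor_of_form_eq hP hg hc h ha',
      existsUnique_mem_singularSet_of_form_eq hP hg hc h hd ha', _, _,
      isRationalFirstIntegral_of_form_eq hP hg hc h hd ha'⟩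
  · have := hpencil P hP ha 1
    rwa [one_smul, inv_one, Matrix.SpecialLinearGroup.coe_one, comp_one, comp_one] at this
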